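/- **Notation.** For $d\ge 0$ let $FM_d=\{FM_d(n)\}_{n\ge 0}$ be the Fulton–MacPherson operad: $FM_d(n)$ is the closure of the set of points $\big((\theta_{ij}),(\delta_{ijk})\big)$, $\theta_{ij}=\frac{p_j-p_i}{\|p_j-p_i\|}\in S^{d-1}$, $\delta_{ijk}=\frac{\|p_i-p_j\|}{\|p_i-p_k\|}\in[0,\infty]$ ($i,j,k$ distinct), for $(p_1,\dots,p_n)\in \mathrm{Conf}_n(\mathbb R^d)$. The coordinates $x_{i,j}:=\theta_{ij}$ are the direction functions on $FM_d(n)$. The symmetric group $\Sigma_n$ permutes the labels, $FM_d(0)$ and $FM_d(1)$ are points, and the composition $\gamma(p;q^{(1)},\dots,q^{(n)})$ replaces the $i$-th point of $p$ by an infinitesimal copy of $q^{(i)}$. Let $FM_\infty(n)=\bigcup_d FM_d(n)$ with the colimit topology and the induced composition $\gamma$; it is the model used for $E(\Sigma_n)$. Let $BU(1)=\mathbb{CP}^\infty$ and $BO(1)=\mathbb{RP}^\infty$, realized as the projectivizations of $\mathbb C[t]$ and $\mathbb R[t]$ (with the topology of the colimits of $\mathbb{CP}^n$ and $\mathbb{RP}^n$),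 with the commutative product induced by multiplication of polynomials; for $\mathbb C$ this is $SP^\infty(\mathbb{CP}^1)$. By stereographic projection from the north pole, $S^2\cong\mathbb C\cup\{\infty\}=\mathbb{CP}^1\subseteq BU(1)$ and $S^1\cong\mathbb R\cup\{\infty\}=\mathbb{RP}^1\subseteq BO(1)$, where $z$ corresponds to $[t-z]$ and $\infty$ to $[1]$. For $w\in\mathbb N^n$ the weighted Atiyah map is $$A_n^w\colon FM_3(n)\to BU(1)^n,\qquad A_n^w(p)_i=\prod_{j\ne i}x_{i,j}(p)^{w_j},$$ and its real version $A_n^{w,\mathbb R}\colon FM_2(n)\to BO(1)^n$ is given by the same formula. For $B=BU(1)$ or $BO(1)$ let $D_n(B)=FM_\infty(n)\times_{\Sigma_n}B^n$ and $D(B)=\bigsqcup_{n\ge0}D_n(B)$. For $n,k_1,\dots,k_n\in\mathbb N$ and $K=\sum_i k_i$ let $$\nu_{n:k_1,\dots,k_n}\colon FM_3(n)\times\prod_{i=1}^n D_{k_i}(BU(1))\to D_K(BU(1)),$$ $$\big(p,[r^{(i)};y_{i,1},\dots,y_{i,k_i}]_{i}\big)\mapsto\Big[\gamma(p;r^{(1)},\dots,r^{(n)});\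 \big(A_n^{(k_1,\dots,k_n)}(p)_i\cdot y_{i,j}\big)_{(i,j)}\Big],$$ with the pairs $(i,j)$, $1\le i\le n$, $1\le j\le k_i$, in lexicographic order and $p$ regarded as a point of $FM_\infty(n)$. Let $\nu^{\mathbb R}_{n:k_1,\dots,k_n}\colon FM_2(n)\times\prod_i D_{k_i}(BO(1))\to D_K(BO(1))$ be defined in the same way from $A_n^{w,\mathbb R}$. **Proposition.** The maps $\nu_{n:k_1,\dots,k_n}$ define an action of the topological operad $FM_3$ on $D(BU(1))$: the resulting maps $FM_3(n)\times D(BU(1))^n\to D(BU(1))$ are continuous, unital, compatible with the operad composition, and compatible with the actions of the symmetric groups. Likewise, the maps $\nu^{\mathbb R}_{n:k_1,\dots,k_n}$ define an action of the topological operad $FM_2$ on $D(BO(1))$. -/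

import Mathlib

open Polynomial Filter Topology
open scoped ENNReal

noncomputable section

namespace AtiyahFM

/-! ## Identifications of index sets of composed arities -/

/-- The block permutation: the `i`-th block is moved to position `σ i`. -/
def blockPerm {n n' : ℕ} (σ : Fin n ≃ Fin n') (m : Fin n' → ℕ) :
    Fin (∑ i, m (σ i)) ≃ Fin (∑ i, m i) :=
  (finSigmaFinEquiv (n := fun i => m (σ i))).symm.trans
    ((Equiv.sigmaCongrLeft (β := fun i => Fin (m i)) σ).trans (finSigmaFinEquiv (n := m)))

/-- The block sum: the `i`-th block is permuted by `τ i`. -/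
def blockSum {n : ℕ} {m m' : Fin n → ℕ} (τ : ∀ i, Fin (m i) ≃ Fin (m' i)) :
    Fin (∑ i, m i) ≃ Fin (∑ i, m' i) :=
  (finSigmaFinEquiv (n := m)).symm.trans
    ((Equiv.sigmaCongrRight τ).trans (finSigmaFinEquiv (n := m')))

/-- The identification of the two ways to bracket a sum of sums; both sides list the triples
`(i, j, k)` lexicographically, so this is the order-preserving bijection. -/
def blockAssoc {n : ℕ} (m : Fin n → ℕ) (l : Fin (∑ i, m i) → ℕ) :
    Fin (∑ c, l c) ≃ Fin (∑ i, ∑ j, l (finSigmaFinEquiv ⟨i, j⟩)) :=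
  (finSigmaFinEquiv (n := l)).symm.trans
    ((Equiv.sigmaCongrLeft (β := fun c => Fin (l c)) (finSigmaFinEquiv (n := m))).symm.trans
      ((Equiv.sigmaAssoc (fun i j => Fin (l (finSigmaFinEquiv ⟨i, j⟩)))).trans
        ((Equiv.sigmaCongrRight (fun i =>
          finSigmaFinEquiv (n := fun j => l (finSigmaFinEquiv ⟨i, j⟩)))).trans
          finSigmaFinEquiv)))

/-- One block of size `n` has `n` elements. -/
def blockOne (n : ℕ) : Fin (∑ _i : Fin 1, n) ≃ Fin n :=
  (finSigmaFinEquiv (n := fun _ : Fin 1 => n)).symm.trans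
    (Equiv.uniqueSigma (fun _ : Fin 1 => Fin n))

/-- `n` blocks of size one have `n` elements. -/
def blockOnes (n : ℕ) : Fin (∑ _i : Fin n, 1) ≃ Fin n :=
  (finSigmaFinEquiv (n := fun _ : Fin n => 1)).symm.trans
    (Equiv.sigmaUnique (Fin n) (fun _ => Fin 1))

theorem blockPerm_symm_apply {n n' : ℕ} (σ : Fin n ≃ Fin n') (m : Fin n' → ℕ) (i : Fin n)
    (j : Fin (m (σ i))) :
    (blockPerm σ m).symm (finSigmaFinEquiv ⟨σ i, j⟩)
      = finSigmaFinEquiv (n := fun i => m (σ i)) ⟨i, j⟩ := by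
  rw [Equiv.symm_apply_eq]
  simp only [blockPerm, Equiv.trans_apply, Equiv.symm_apply_apply]
  rfl

theorem blockSum_symm_apply {n : ℕ} {m m' : Fin n → ℕ} (τ : ∀ i, Fin (m i) ≃ Fin (m' i))
    (i : Fin n) (j : Fin (m' i)) :
    (blockSum τ).symm (finSigmaFinEquiv ⟨i, j⟩) = finSigmaFinEquiv ⟨i, (τ i).symm j⟩ := by
  rw [Equiv.symm_apply_eq]
  simp [blockSum, Equiv.trans_apply, Equiv.symm_apply_apply, Equiv.sigmaCongrRight]

theorem blockAssoc_symm_apply {n : ℕ} (m : Fin n → ℕ) (l : Fin (∑ i, m i) → ℕ) (i : Fin n)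
    (j : Fin (m i)) (k : Fin (l (finSigmaFinEquiv ⟨i, j⟩))) :
    (blockAssoc m l).symm
        (finSigmaFinEquiv ⟨i, finSigmaFinEquiv (n := fun j => l (finSigmaFinEquiv ⟨i, j⟩)) ⟨j, k⟩⟩)
      = finSigmaFinEquiv (n := l) ⟨finSigmaFinEquiv ⟨i, j⟩, k⟩ := by
  rw [Equiv.symm_apply_eq]
  have h : (Equiv.sigmaCongrLeft (β := fun c => Fin (l c)) (finSigmaFinEquiv (n := m))).symm
      ⟨finSigmaFinEquiv ⟨i, j⟩, k⟩ = ⟨⟨i, j⟩, k⟩ := by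
    rw [Equiv.symm_apply_eq]; rfl
  simp only [blockAssoc, Equiv.trans_apply, Equiv.symm_apply_apply, h]
  rfl

theorem blockOne_symm_apply (n : ℕ) (j : Fin n) :
    (blockOne n).symm j = finSigmaFinEquiv (n := fun _ : Fin 1 => n) ⟨0, j⟩ := rfl

theorem blockOnes_symm_apply (n : ℕ) (j : Fin n) :
    (blockOnes n).symm j = finSigmaFinEquiv (n := fun _ : Fin n => 1) ⟨j, 0⟩ := by
  rw [Equiv.symm_apply_eq]
  simp [blockOnes]

/-! ## Topological operads and their algebras -/

/-- A (symmetric, topological) operad.  The action of the symmetric groups is recorded as a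
functor on bijections `Fin m ≃ Fin n`: for `m = n` it is the action of the symmetric group, and
it also provides the identification of `Op m` with `Op n` when `m` and `n` are equal but not
syntactically so. -/
structure TopOperad where
  Op : ℕ → Type
  top : ∀ n, TopologicalSpace (Op n)
  one : Op 1
  map : ∀ {m n : ℕ}, (Fin m ≃ Fin n) → Op m → Op n
  comp : ∀ {n : ℕ} (m : Fin n → ℕ), Op n → (∀ i, Op (m i)) → Op (∑ i, m i)
  continuous_map : ∀ {m n : ℕ} (σ : Fin m ≃ Fin n), Continuous (map σ)
  continuous_comp : ∀ {n : ℕ} (m : Fin n → ℕ),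
    Continuous (fun x : Op n × (∀ i, Op (m i)) => comp m x.1 x.2)
  map_refl : ∀ {n : ℕ} (p : Op n), map (Equiv.refl (Fin n)) p = p
  map_trans : ∀ {l m n : ℕ} (σ : Fin l ≃ Fin m) (τ : Fin m ≃ Fin n) (p : Op l),
    map (σ.trans τ) p = map τ (map σ p)
  one_comp : ∀ {n : ℕ} (p : Op n),
    map (blockOne n) (comp (fun _ : Fin 1 => n) one (fun _ => p)) = p
  comp_one : ∀ {n : ℕ} (p : Op n),
    map (blockOnes n) (comp (fun _ : Fin n => 1) p (fun _ => one)) = p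
  comp_assoc : ∀ {n : ℕ} (m : Fin n → ℕ) (l : Fin (∑ i, m i) → ℕ) (p : Op n)
    (q : ∀ i, Op (m i)) (r : ∀ c, Op (l c)),
    map (blockAssoc m l) (comp l (comp m p q) r)
      = comp (fun i => ∑ j, l (finSigmaFinEquiv ⟨i, j⟩)) p
          (fun i => comp (fun j => l (finSigmaFinEquiv ⟨i, j⟩)) (q i)
            (fun j => r (finSigmaFinEquiv ⟨i, j⟩)))
  comp_map_left : ∀ {n n' : ℕ} (σ : Fin n ≃ Fin n') (m : Fin n' → ℕ) (p : Op n)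
    (q : ∀ i, Op (m i)),
    comp m (map σ p) q = map (blockPerm σ m) (comp (fun i => m (σ i)) p (fun i => q (σ i)))
  comp_map_right : ∀ {n : ℕ} {m m' : Fin n → ℕ} (τ : ∀ i, Fin (m i) ≃ Fin (m' i)) (p : Op n)
    (q : ∀ i, Op (m i)),
    comp m' p (fun i => map (τ i) (q i)) = map (blockSum τ) (comp m p q)

attribute [instance] TopOperad.top

/-- The maps `act n : P(n) × Xⁿ → X` define an action of the operad `P` on the space `X`. -/
structure IsOperadAction (P : TopOperad) (X : Type) [TopologicalSpace X]
    (act : ∀ n : ℕ, P.Op n → (Fin n → X) → X) : Prop where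
  continuous_act : ∀ n, Continuous (fun z : P.Op n × (Fin n → X) => act n z.1 z.2)
  act_one : ∀ y : Fin 1 → X, act 1 P.one y = y 0
  act_comp : ∀ {n : ℕ} (m : Fin n → ℕ) (p : P.Op n) (q : ∀ i, P.Op (m i))
    (y : Fin (∑ i, m i) → X),
    act (∑ i, m i) (P.comp m p q) y
      = act n p (fun i => act (m i) (q i) (fun j => y (finSigmaFinEquiv ⟨i, j⟩)))
  act_map : ∀ {m n : ℕ} (σ : Fin m ≃ Fin n) (p : P.Op m) (y : Fin n → X),
    act n (P.map σ p) y = act m p (fun i => y (σ i))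

/-! ## Coordinates of the Fulton–MacPherson compactification -/

/-- Families of directions `θ i j` (with values in `V`) and of relative distances
`δ i j k ∈ [0, ∞]`, for labels in `I`. -/
abbrev Coord (I : Type) (V : Type) : Type := (I → I → V) × (I → I → I → ℝ≥0∞)

/-- The coordinates of a configuration `x`: `θ i j = (x j - x i) / ‖x j - x i‖` and
`δ i j k = ‖x i - x j‖ / ‖x i - x k‖`.  For injective `x`, the coordinates with repeated indices
are constants (`θ i i = 0`, `δ i i k = 0`, `δ i j i = ∞` and `δ i j j = 1` for `j ≠ i ≠ k`), so
they carry no information. -/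
def configCoord {I E : Type} [NormedAddCommGroup E] [NormedSpace ℝ E] (x : I → E) : Coord I E :=
  (fun i j => ‖x j - x i‖⁻¹ • (x j - x i), fun i j k => ‖x i - x j‖ₑ / ‖x i - x k‖ₑ)

/-- The compactified configuration space of `I`-labelled points in `E`, modulo translations and
dilations: the closure of the set of coordinates of configurations of distinct points. -/
def fmSet (I E : Type) [NormedAddCommGroup E] [NormedSpace ℝ E] : Set (Coord I E) :=
  closure {c | ∃ x : I → E, Function.Injective x ∧ c = configCoord x}

/-- Renaming the labels along a bijection. -/
def relabel {I I' V : Type} (e : I ≃ I') (c : Coord I V) : Coord I' V :=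
  (fun i j => c.1 (e.symm i) (e.symm j), fun i j k => c.2 (e.symm i) (e.symm j) (e.symm k))

/-- Operadic composition in coordinates: the point `i` of `p` is replaced by an infinitesimal
copy of `q i`. -/
def compCoord {I V : Type} [DecidableEq I] {J : I → Type} (p : Coord I V)
    (q : ∀ i, Coord (J i) V) : Coord (Σ i, J i) V :=
  (fun a b => if h : b.1 = a.1 then (q a.1).1 a.2 (h ▸ b.2) else p.1 a.1 b.1,
   fun a b c =>
    if hb : b.1 = a.1 then
      if hc : c.1 = a.1 then (q a.1).2 a.2 (hb ▸ b.2) (hc ▸ c.2) else 0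
    else if c.1 = a.1 then ∞ else p.2 a.1 b.1 c.1)

/-- Applying a map to all directions. -/
def mapDir {I V W : Type} (f : V → W) (c : Coord I V) : Coord I W :=
  (fun i j => f (c.1 i j), c.2)

section CoordLemmas

theorem continuous_relabel {I I' V : Type} [TopologicalSpace V] (e : I ≃ I') :
    Continuous (relabel (V := V) e) := by
  unfold relabel; fun_prop

variable {I V W : Type} [DecidableEq I] {J : I → Type}

theorem comp_dir_same (p : Coord I V) (q : ∀ i, Coord (J i) V) (i : I) (j k : J i) :
    (compCoord p q).1 ⟨i, j⟩ ⟨i, k⟩ = (q i).1 j k := by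
  simp [compCoord]

theorem comp_dir_ne (p : Coord I V) (q : ∀ i, Coord (J i) V) {i h : I} (hi : h ≠ i) (j : J i)
    (k : J h) : (compCoord p q).1 ⟨i, j⟩ ⟨h, k⟩ = p.1 i h := by
  simp [compCoord, hi]

theorem comp_rat_same (p : Coord I V) (q : ∀ i, Coord (J i) V) (i : I) (j k l : J i) :
    (compCoord p q).2 ⟨i, j⟩ ⟨i, k⟩ ⟨i, l⟩ = (q i).2 j k l := by
  simp [compCoord]

theorem comp_rat_zero (p : Coord I V) (q : ∀ i, Coord (J i) V) {i h : I} (hi : h ≠ i)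
    (j k : J i) (l : J h) : (compCoord p q).2 ⟨i, j⟩ ⟨i, k⟩ ⟨h, l⟩ = 0 := by
  simp [compCoord, hi]

theorem comp_rat_top (p : Coord I V) (q : ∀ i, Coord (J i) V) {i h : I} (hi : h ≠ i)
    (j l : J i) (k : J h) : (compCoord p q).2 ⟨i, j⟩ ⟨h, k⟩ ⟨i, l⟩ = ∞ := by
  simp [compCoord, hi]

theorem comp_rat_ne (p : Coord I V) (q : ∀ i, Coord (J i) V) {i h h' : I} (hi : h ≠ i)
    (hi' : h' ≠ i) (j : J i) (k : J h) (l : J h') :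
    (compCoord p q).2 ⟨i, j⟩ ⟨h, k⟩ ⟨h', l⟩ = p.2 i h h' := by
  simp [compCoord, hi, hi']

theorem mapDir_comp (f : V → W) (p : Coord I V) (q : ∀ i, Coord (J i) V) :
    mapDir f (compCoord p q) = compCoord (mapDir f p) (fun i => mapDir f (q i)) := by
  ext a b
  · simp only [mapDir, compCoord]; split_ifs <;> rfl
  · rfl

theorem continuous_compCoord [TopologicalSpace V] :
    Continuous (fun x : Coord I V × (∀ i, Coord (J i) V) => compCoord x.1 x.2) := by
  refine Continuous.prodMk ?_ ?_
  · refine continuous_pi fun a => continuous_pi fun b => ?_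
    by_cases h : b.1 = a.1
    · simp only [h, dite_true]; fun_prop
    · simp only [h, dite_false]; fun_prop
  · refine continuous_pi fun a => continuous_pi fun b => continuous_pi fun c => ?_
    by_cases h : b.1 = a.1
    · by_cases h' : c.1 = a.1
      · simp only [h, h', dite_true]; fun_prop
      · simp only [h, h', dite_true, dite_false]; fun_prop
    · by_cases h' : c.1 = a.1
      · simp only [h, h', dite_false, if_true]; fun_prop
      · simp only [h, h', dite_false, if_false]; fun_prop

end CoordLemmas

section Closure

variable {I I' E F : Type} [NormedAddCommGroup E] [NormedSpace ℝ E] [NormedAddCommGroup F]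
  [NormedSpace ℝ F]

theorem configCoord_mem {x : I → E} (hx : Function.Injective x) : configCoord x ∈ fmSet I E :=
  subset_closure ⟨x, hx, rfl⟩

theorem relabel_mem (e : I ≃ I') {c : Coord I E} (hc : c ∈ fmSet I E) :
    relabel e c ∈ fmSet I' E := by
  classical
  refine map_mem_closure (continuous_relabel e) hc ?_
  rintro _ ⟨x, hx, rfl⟩
  exact ⟨x ∘ e.symm, hx.comp e.symm.injective, rfl⟩

theorem mapDir_mem (f : E →ₗᵢ[ℝ] F) {c : Coord I E} (hc : c ∈ fmSet I E) :
    mapDir f c ∈ fmSet I F := by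
  have hf : Continuous (mapDir (I := I) f) := by
    have := f.continuous
    unfold mapDir; fun_prop
  refine map_mem_closure hf hc ?_
  rintro _ ⟨x, hx, rfl⟩
  refine ⟨f ∘ x, f.injective.comp hx, ?_⟩
  have h : ∀ v, ‖f v‖ₑ = ‖v‖ₑ := fun v => by
    rw [← ofReal_norm, ← ofReal_norm, f.norm_map]
  ext i j
  · simp [mapDir, configCoord, ← map_sub]
  · simp [mapDir, configCoord, ← map_sub, h]

/-- Coordinates with repeated indices are constant. -/
theorem dir_self {c : Coord I E} (hc : c ∈ fmSet I E) (i : I) : c.1 i i = 0 := by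
  have hcl : IsClosed {c : Coord I E | c.1 i i = 0} :=
    isClosed_eq (by fun_prop) continuous_const
  refine closure_minimal ?_ hcl hc
  rintro _ ⟨x, -, rfl⟩
  simp [configCoord]

theorem rat_self {c : Coord I E} (hc : c ∈ fmSet I E) (i k : I) : c.2 i i k = 0 := by
  have hcl : IsClosed {c : Coord I E | c.2 i i k = 0} :=
    isClosed_eq (by fun_prop) continuous_const
  refine closure_minimal ?_ hcl hc
  rintro _ ⟨x, -, rfl⟩
  simp [configCoord]

theorem rat_top {c : Coord I E} (hc : c ∈ fmSet I E) {i j : I} (h : j ≠ i) :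
    c.2 i j i = ∞ := by
  have hcl : IsClosed {c : Coord I E | c.2 i j i = ∞} :=
    isClosed_eq (by fun_prop) continuous_const
  refine closure_minimal ?_ hcl hc
  rintro _ ⟨x, hx, rfl⟩
  have : x i - x j ≠ 0 := sub_ne_zero.2 fun e => h (hx e).symm
  simp [configCoord, ENNReal.div_zero, this]

theorem compCoord_mem [Finite I] [DecidableEq I] {J : I → Type} [∀ i, Finite (J i)]
    {p : Coord I E} {q : ∀ i, Coord (J i) E} (hp : p ∈ fmSet I E)
    (hq : ∀ i, q i ∈ fmSet (J i) E) : compCoord p q ∈ fmSet (Σ i, J i) E := by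
  have hpq : (p, q) ∈ closure ({c | ∃ x : I → E, Function.Injective x ∧ c = configCoord x} ×ˢ
      Set.univ.pi fun i => {c | ∃ x : J i → E, Function.Injective x ∧ c = configCoord x}) := by
    rw [closure_prod_eq, closure_pi_set]
    exact ⟨hp, fun i _ => hq i⟩
  have key : compCoord p q ∈ closure (fmSet (Σ i, J i) E) := by
    refine map_mem_closure
      (f := fun x : Coord I E × (∀ i, Coord (J i) E) => compCoord x.1 x.2)
      continuous_compCoord hpq ?_
    rintro ⟨p, q⟩ ⟨⟨x, hx, rfl⟩, hq⟩
    have hq' : ∀ i, ∃ y : J i → E, Function.Injective y ∧ q i = configCoord y :=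
      fun i => hq i (Set.mem_univ i)
    choose y hy hqy using hq'
    obtain rfl : q = fun i => configCoord (y i) := funext hqy
    clear hq hqy hpq
    let z : ℝ → (Σ i, J i) → E := fun ε a => x a.1 + ε • y a.1 a.2
    have hz : ∀ a b, Tendsto (fun ε => z ε a - z ε b) (𝓝[>] 0) (𝓝 (x a.1 - x b.1)) := by
      intro a b
      have : Continuous fun ε => z ε a - z ε b := by fun_prop
      simpa [z] using (this.tendsto 0).mono_left nhdsWithin_le_nhds
    have hpos : ∀ᶠ ε : ℝ in 𝓝[>] 0, 0 < ε := self_mem_nhdsWithin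
    have hne : ∀ {a b : I}, b ≠ a → x a - x b ≠ 0 := fun h =>
      sub_ne_zero.2 fun e => h (hx e).symm
    have hinj : ∀ᶠ ε in 𝓝[>] (0 : ℝ), Function.Injective (z ε) := by
      have h1 : ∀ᶠ ε in 𝓝[>] (0 : ℝ), ∀ a b, a ≠ b → z ε a ≠ z ε b := by
        rw [eventually_all]; intro a
        rw [eventually_all]; intro b
        by_cases hab : a = b
        · simp [hab]
        obtain ⟨i, j⟩ := a
        obtain ⟨h, k⟩ := b
        by_cases hi : h = i
        · subst hi
          have hjk : j ≠ k := fun e => hab (by rw [e])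
          filter_upwards [hpos] with ε hε _ e
          refine hjk (hy h ?_)
          have e' : ε • y h j = ε • y h k := by simpa [z] using e
          exact smul_right_injective E hε.ne' e'
        · have := (hz ⟨i, j⟩ ⟨h, k⟩).eventually_ne (hne hi)
          filter_upwards [this] with ε hε _ e
          exact hε (sub_eq_zero.2 e)
      filter_upwards [h1] with ε hε a b hab
      by_contra h
      exact hε a b h hab
    have hsame : ∀ (ε : ℝ) (i : I) (j k : J i),
        z ε ⟨i, j⟩ - z ε ⟨i, k⟩ = ε • (y i j - y i k) := by
      intro ε i j k
      simp [z, smul_sub]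
    have hlim : Tendsto (fun ε => configCoord (z ε)) (𝓝[>] (0 : ℝ))
        (𝓝 (compCoord (configCoord x) (fun i => configCoord (y i)))) := by
      rw [Prod.tendsto_iff]
      refine ⟨tendsto_pi_nhds.2 fun a => tendsto_pi_nhds.2 fun b => ?_,
        tendsto_pi_nhds.2 fun a => tendsto_pi_nhds.2 fun b => tendsto_pi_nhds.2 fun c => ?_⟩
      · obtain ⟨i, j⟩ := a
        obtain ⟨h, k⟩ := b
        by_cases hi : h = i
        · subst hi
          rw [comp_dir_same]
          refine tendsto_const_nhds.congr' ?_
          filter_upwards [hpos] with ε hε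
          simp only [configCoord, hsame, norm_smul, smul_smul, mul_inv, Real.norm_eq_abs,
            abs_of_pos hε]
          congr 1
          field_simp
        · rw [comp_dir_ne _ _ hi]
          have h0 := hz ⟨h, k⟩ ⟨i, j⟩
          exact (h0.norm.inv₀ (norm_ne_zero_iff.2 (hne (Ne.symm hi)))).smul h0
      · obtain ⟨i, j⟩ := a
        obtain ⟨h, k⟩ := b
        obtain ⟨g, l⟩ := c
        have hb := (hz ⟨i, j⟩ ⟨h, k⟩).enorm
        have hc := (hz ⟨i, j⟩ ⟨g, l⟩).enorm
        by_cases hi : h = i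
        · subst hi
          by_cases hg : g = h
          · subst hg
            rw [comp_rat_same]
            refine tendsto_const_nhds.congr' ?_
            filter_upwards [hpos] with ε hε
            simp only [configCoord, hsame, enorm_smul]
            rw [ENNReal.mul_div_mul_left _ _ (by simpa using hε.ne') (by simp)]
          · rw [comp_rat_zero _ _ hg]
            have := ENNReal.Tendsto.div hb (Or.inr (by simpa using hne hg)) hc (Or.inr (by simp))
            simpa [configCoord] using this
        · by_cases hg : g = i
          · subst hg
            rw [comp_rat_top _ _ hi]
            have := ENNReal.Tendsto.div hb (Or.inl (by simpa using hne hi)) hc (Or.inr (by simp))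
            simpa [configCoord, ENNReal.div_zero, hne hi] using this
          · rw [comp_rat_ne _ _ hi hg]
            exact ENNReal.Tendsto.div hb (Or.inr (by simpa using hne hg)) hc (Or.inl (by simp))
    refine mem_closure_of_tendsto hlim ?_
    filter_upwards [hinj] with ε hε
    exact ⟨z ε, hε, rfl⟩
  rwa [fmSet, closure_closure] at key

end Closure

/-! ## Composition for standard index sets -/

/-- Composition in coordinates, with the labels `(i, j)` numbered lexicographically. -/
def compFin {V : Type} {n : ℕ} (m : Fin n → ℕ) (p : Coord (Fin n) V)
    (q : ∀ i, Coord (Fin (m i)) V) : Coord (Fin (∑ i, m i)) V :=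
  relabel finSigmaFinEquiv (compCoord p q)

section CompFin

variable {V W : Type} {n n' : ℕ} {m m' : Fin n → ℕ}

/-- Equality of coordinates on a sum of blocks can be checked on labels `(i, j)`. -/
theorem coord_ext_blocks {c c' : Coord (Fin (∑ i, m i)) V}
    (hd : ∀ i j h k, c.1 (finSigmaFinEquiv ⟨i, j⟩) (finSigmaFinEquiv ⟨h, k⟩)
      = c'.1 (finSigmaFinEquiv ⟨i, j⟩) (finSigmaFinEquiv ⟨h, k⟩))
    (hr : ∀ i j h k g l,
      c.2 (finSigmaFinEquiv ⟨i, j⟩) (finSigmaFinEquiv ⟨h, k⟩) (finSigmaFinEquiv ⟨g, l⟩)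
      = c'.2 (finSigmaFinEquiv ⟨i, j⟩) (finSigmaFinEquiv ⟨h, k⟩) (finSigmaFinEquiv ⟨g, l⟩)) :
    c = c' := by
  refine Prod.ext (funext fun a => funext fun b => ?_)
    (funext fun a => funext fun b => funext fun e => ?_)
  · obtain ⟨⟨i, j⟩, rfl⟩ := finSigmaFinEquiv.surjective a
    obtain ⟨⟨h, k⟩, rfl⟩ := finSigmaFinEquiv.surjective b
    exact hd i j h k
  · obtain ⟨⟨i, j⟩, rfl⟩ := finSigmaFinEquiv.surjective a
    obtain ⟨⟨h, k⟩, rfl⟩ := finSigmaFinEquiv.surjective b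
    obtain ⟨⟨g, l⟩, rfl⟩ := finSigmaFinEquiv.surjective e
    exact hr i j h k g l

theorem compFin_dir (p : Coord (Fin n) V) (q : ∀ i, Coord (Fin (m i)) V) (a b) :
    (compFin m p q).1 (finSigmaFinEquiv a) (finSigmaFinEquiv b) = (compCoord p q).1 a b := by
  simp [compFin, relabel]

theorem compFin_rat (p : Coord (Fin n) V) (q : ∀ i, Coord (Fin (m i)) V) (a b c) :
    (compFin m p q).2 (finSigmaFinEquiv a) (finSigmaFinEquiv b) (finSigmaFinEquiv c)
      = (compCoord p q).2 a b c := by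
  simp [compFin, relabel]

theorem mapDir_relabel {I I' : Type} (f : V → W) (e : I ≃ I') (c : Coord I V) :
    mapDir f (relabel e c) = relabel e (mapDir f c) := rfl

theorem mapDir_compFin (f : V → W) (p : Coord (Fin n) V) (q : ∀ i, Coord (Fin (m i)) V) :
    mapDir f (compFin m p q) = compFin m (mapDir f p) (fun i => mapDir f (q i)) := by
  rw [compFin, mapDir_relabel, mapDir_comp]; rfl

theorem compFin_relabel_left (σ : Fin n ≃ Fin n') (m : Fin n' → ℕ) (p : Coord (Fin n) V)
    (q : ∀ i, Coord (Fin (m i)) V) :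
    compFin m (relabel σ p) q
      = relabel (blockPerm σ m) (compFin (fun i => m (σ i)) p (fun i => q (σ i))) := by
  refine coord_ext_blocks ?_ ?_
  · intro i j h k
    obtain ⟨i, rfl⟩ := σ.surjective i
    obtain ⟨h, rfl⟩ := σ.surjective h
    rw [compFin_dir]
    simp only [relabel, blockPerm_symm_apply, compFin_dir]
    by_cases hi : h = i
    · subst hi; simp only [comp_dir_same]
    · rw [comp_dir_ne _ _ hi, comp_dir_ne _ _ (by simpa using hi)]; simp
  · intro i j h k g l
    obtain ⟨i, rfl⟩ := σ.surjective i
    obtain ⟨h, rfl⟩ := σ.surjective h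
    obtain ⟨g, rfl⟩ := σ.surjective g
    rw [compFin_rat]
    simp only [relabel, blockPerm_symm_apply, compFin_rat]
    by_cases hi : h = i
    · subst hi
      by_cases hg : g = h
      · subst hg; simp only [comp_rat_same]
      · rw [comp_rat_zero _ _ hg, comp_rat_zero _ _ (by simpa using hg)]
    · by_cases hg : g = i
      · subst hg; rw [comp_rat_top _ _ hi, comp_rat_top _ _ (by simpa using hi)]
      · rw [comp_rat_ne _ _ hi hg, comp_rat_ne _ _ (by simpa using hi) (by simpa using hg)]
        simp

theorem compFin_relabel_right (τ : ∀ i, Fin (m i) ≃ Fin (m' i)) (p : Coord (Fin n) V)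
    (q : ∀ i, Coord (Fin (m i)) V) :
    compFin m' p (fun i => relabel (τ i) (q i)) = relabel (blockSum τ) (compFin m p q) := by
  refine coord_ext_blocks ?_ ?_
  · intro i j h k
    rw [compFin_dir]
    simp only [relabel, blockSum_symm_apply, compFin_dir]
    by_cases hi : h = i
    · subst hi; simp only [comp_dir_same]
    · rw [comp_dir_ne _ _ hi, comp_dir_ne _ _ hi]
  · intro i j h k g l
    rw [compFin_rat]
    simp only [relabel, blockSum_symm_apply, compFin_rat]
    by_cases hi : h = i
    · subst hi
      by_cases hg : g = h
      · subst hg; simp only [comp_rat_same]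
      · rw [comp_rat_zero _ _ hg, comp_rat_zero _ _ hg]
    · by_cases hg : g = i
      · subst hg; rw [comp_rat_top _ _ hi, comp_rat_top _ _ hi]
      · rw [comp_rat_ne _ _ hi hg, comp_rat_ne _ _ hi hg]

theorem compFin_assoc (l : Fin (∑ i, m i) → ℕ) (p : Coord (Fin n) V)
    (q : ∀ i, Coord (Fin (m i)) V) (r : ∀ c, Coord (Fin (l c)) V) :
    relabel (blockAssoc m l) (compFin l (compFin m p q) r)
      = compFin (fun i => ∑ j, l (finSigmaFinEquiv ⟨i, j⟩)) p
          (fun i => compFin (fun j => l (finSigmaFinEquiv ⟨i, j⟩)) (q i)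
            (fun j => r (finSigmaFinEquiv ⟨i, j⟩))) := by
  have hne : ∀ {a b : Σ i, Fin (m i)}, b ≠ a →
      (finSigmaFinEquiv b : Fin (∑ i, m i)) ≠ finSigmaFinEquiv a :=
    fun h e => h (finSigmaFinEquiv.injective e)
  have hfst : ∀ {i h : Fin n} {j : Fin (m i)} {k : Fin (m h)}, h ≠ i →
      (⟨h, k⟩ : Σ i, Fin (m i)) ≠ ⟨i, j⟩ := fun hi e => hi (congrArg Sigma.fst e)
  have hsnd : ∀ {i : Fin n} {j k : Fin (m i)}, k ≠ j →
      (⟨i, k⟩ : Σ i, Fin (m i)) ≠ ⟨i, j⟩ := fun hk e => hk (by simpa using e)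
  refine coord_ext_blocks ?_ ?_
  · intro i x h y
    obtain ⟨⟨j, k⟩, rfl⟩ := finSigmaFinEquiv.surjective x
    obtain ⟨⟨j', k'⟩, rfl⟩ := finSigmaFinEquiv.surjective y
    rw [compFin_dir]
    simp only [relabel]
    rw [blockAssoc_symm_apply, blockAssoc_symm_apply, compFin_dir]
    by_cases hi : h = i
    · subst hi
      rw [comp_dir_same, compFin_dir]
      by_cases hj : j' = j
      · subst hj; rw [comp_dir_same, comp_dir_same]
      · rw [comp_dir_ne _ _ hj, comp_dir_ne _ _ (hne (hsnd hj)), compFin_dir, comp_dir_same]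
    · rw [comp_dir_ne _ _ hi, comp_dir_ne _ _ (hne (hfst hi)), compFin_dir, comp_dir_ne _ _ hi]
  · intro i x h y g z
    obtain ⟨⟨j, k⟩, rfl⟩ := finSigmaFinEquiv.surjective x
    obtain ⟨⟨j', k'⟩, rfl⟩ := finSigmaFinEquiv.surjective y
    obtain ⟨⟨j'', k''⟩, rfl⟩ := finSigmaFinEquiv.surjective z
    rw [compFin_rat]
    simp only [relabel]
    rw [blockAssoc_symm_apply, blockAssoc_symm_apply, blockAssoc_symm_apply, compFin_rat]
    by_cases hi : h = i
    · subst hi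
      by_cases hg : g = h
      · subst hg
        rw [comp_rat_same, compFin_rat]
        by_cases hj : j' = j
        · subst hj
          by_cases hj' : j'' = j'
          · subst hj'; rw [comp_rat_same, comp_rat_same]
          · rw [comp_rat_zero _ _ hj', comp_rat_zero _ _ (hne (hsnd hj'))]
        · by_cases hj' : j'' = j
          · subst hj'; rw [comp_rat_top _ _ hj, comp_rat_top _ _ (hne (hsnd hj))]
          · rw [comp_rat_ne _ _ hj hj', comp_rat_ne _ _ (hne (hsnd hj)) (hne (hsnd hj')),
              compFin_rat, comp_rat_same]
      · rw [comp_rat_zero _ _ hg]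
        by_cases hj : j' = j
        · subst hj; rw [comp_rat_zero _ _ (hne (hfst hg))]
        · rw [comp_rat_ne _ _ (hne (hsnd hj)) (hne (hfst hg)), compFin_rat, comp_rat_zero _ _ hg]
    · by_cases hg : g = i
      · subst hg
        rw [comp_rat_top _ _ hi]
        by_cases hj : j'' = j
        · subst hj; rw [comp_rat_top _ _ (hne (hfst hi))]
        · rw [comp_rat_ne _ _ (hne (hfst hi)) (hne (hsnd hj)), compFin_rat, comp_rat_top _ _ hi]
      · rw [comp_rat_ne _ _ hi hg, comp_rat_ne _ _ (hne (hfst hi)) (hne (hfst hg)), compFin_rat,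
          comp_rat_ne _ _ hi hg]

theorem continuous_compFin [TopologicalSpace V] (m : Fin n → ℕ) :
    Continuous (fun x : Coord (Fin n) V × (∀ i, Coord (Fin (m i)) V) => compFin m x.1 x.2) :=
  (continuous_relabel _).comp continuous_compCoord

variable {E : Type} [NormedAddCommGroup E] [NormedSpace ℝ E]

theorem compFin_mem {p : Coord (Fin n) E} {q : ∀ i, Coord (Fin (m i)) E}
    (hp : p ∈ fmSet (Fin n) E) (hq : ∀ i, q i ∈ fmSet (Fin (m i)) E) :
    compFin m p q ∈ fmSet (Fin (∑ i, m i)) E :=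
  relabel_mem _ (compCoord_mem hp hq)

theorem one_compFin (o : Coord (Fin 1) V) (p : Coord (Fin n) V) :
    relabel (blockOne n) (compFin (fun _ : Fin 1 => n) o (fun _ => p)) = p := by
  refine Prod.ext (funext fun a => funext fun b => ?_)
    (funext fun a => funext fun b => funext fun e => ?_)
  · simp only [relabel, blockOne_symm_apply, compFin_dir, comp_dir_same]
  · simp only [relabel, blockOne_symm_apply, compFin_rat, comp_rat_same]

theorem compFin_one {o : Coord (Fin 1) E} {p : Coord (Fin n) E} (ho : o ∈ fmSet (Fin 1) E)
    (hp : p ∈ fmSet (Fin n) E) :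
    relabel (blockOnes n) (compFin (fun _ : Fin n => 1) p (fun _ => o)) = p := by
  refine Prod.ext (funext fun a => funext fun b => ?_)
    (funext fun a => funext fun b => funext fun e => ?_)
  · simp only [relabel, blockOnes_symm_apply, compFin_dir]
    by_cases hb : b = a
    · subst hb; rw [comp_dir_same, dir_self ho, dir_self hp]
    · rw [comp_dir_ne _ _ hb]
  · simp only [relabel, blockOnes_symm_apply, compFin_rat]
    by_cases hb : b = a
    · subst hb
      rw [rat_self hp]
      by_cases he : e = b
      · subst he; rw [comp_rat_same, rat_self ho]
      · rw [comp_rat_zero _ _ he]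
    · by_cases he : e = a
      · subst he; rw [comp_rat_top _ _ hb, rat_top hp hb]
      · rw [comp_rat_ne _ _ hb he]

end CompFin

/-! ## The Fulton–MacPherson operad in finite dimension -/

/-- The Fulton–MacPherson space `FM_d(n)`. -/
def FM (d n : ℕ) : Type :=
  {c : Coord (Fin n) (EuclideanSpace ℝ (Fin d)) // c ∈ fmSet (Fin n) (EuclideanSpace ℝ (Fin d))}

instance (d n : ℕ) : TopologicalSpace (FM d n) :=
  inferInstanceAs (TopologicalSpace {c : Coord (Fin n) (EuclideanSpace ℝ (Fin d)) //
    c ∈ fmSet (Fin n) (EuclideanSpace ℝ (Fin d))})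

/-- The direction functions `x i j` on `FM_d(n)`. -/
def FM.dir {d n : ℕ} (p : FM d n) (i j : Fin n) : EuclideanSpace ℝ (Fin d) := p.1.1 i j

/-- The unit of the Fulton–MacPherson operad. -/
def FM.one (d : ℕ) : FM d 1 :=
  ⟨configCoord (fun _ => 0), configCoord_mem (Function.injective_of_subsingleton _)⟩

/-- Renaming of labels in `FM_d`. -/
def FM.map {d m n : ℕ} (σ : Fin m ≃ Fin n) (p : FM d m) : FM d n :=
  ⟨relabel σ p.1, relabel_mem σ p.2⟩

/-- Operadic composition in `FM_d`. -/
def FM.comp {d n : ℕ} (m : Fin n → ℕ) (p : FM d n) (q : ∀ i, FM d (m i)) : FM d (∑ i, m i) :=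
  ⟨compFin m p.1 (fun i => (q i).1), compFin_mem p.2 (fun i => (q i).2)⟩

/-- The Fulton–MacPherson operad `FM_d`. -/
def fultonMacPherson (d : ℕ) : TopOperad where
  Op := FM d
  top := inferInstance
  one := FM.one d
  map := FM.map
  comp := FM.comp
  continuous_map σ := Continuous.subtype_mk ((continuous_relabel σ).comp continuous_subtype_val) _
  continuous_comp m := by
    refine Continuous.subtype_mk ((continuous_compFin m).comp
      (Continuous.prodMk (continuous_subtype_val.comp continuous_fst)
        (continuous_pi fun i => continuous_subtype_val.comp
          ((continuous_apply i).comp continuous_snd)))) _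
  map_refl p := rfl
  map_trans σ τ p := rfl
  one_comp p := Subtype.ext (one_compFin _ p.1)
  comp_one p := Subtype.ext
    (compFin_one (configCoord_mem (Function.injective_of_subsingleton _)) p.2)
  comp_assoc m l p q r := Subtype.ext
    (compFin_assoc l p.1 (fun i => (q i).1) (fun c => (r c).1))
  comp_map_left σ m p q := Subtype.ext (compFin_relabel_left σ m p.1 (fun i => (q i).1))
  comp_map_right τ p q := Subtype.ext (compFin_relabel_right τ p.1 (fun i => (q i).1))

/-! ## The infinite-dimensional Fulton–MacPherson spaces -/

/-- The inclusion of `ℝ^d` into `ℝ^d'` for `d ≤ d'` (extension by zero). -/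
def euclExtend {d d' : ℕ} (h : d ≤ d') :
    EuclideanSpace ℝ (Fin d) →ₗᵢ[ℝ] EuclideanSpace ℝ (Fin d') where
  toFun v := WithLp.toLp 2 fun k => if hk : (k : ℕ) < d then v ⟨k, hk⟩ else 0
  map_add' v w := by
    ext k
    by_cases hk : (k : ℕ) < d <;> simp [hk]
  map_smul' a v := by
    ext k
    by_cases hk : (k : ℕ) < d <;> simp [hk]
  norm_map' v := by
    obtain ⟨e, rfl⟩ := Nat.exists_eq_add_of_le h
    simp [EuclideanSpace.norm_eq, Fin.sum_univ_add]

/-- The inclusion of `ℝ^d` into `ℝ^∞` (extension by zero). -/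
def euclPad {d : ℕ} (v : EuclideanSpace ℝ (Fin d)) : ℕ → ℝ :=
  fun k => if hk : k < d then v ⟨k, hk⟩ else 0

theorem euclPad_extend {d d' : ℕ} (h : d ≤ d') (v : EuclideanSpace ℝ (Fin d)) :
    euclPad (euclExtend h v) = euclPad v := by
  funext k
  by_cases hk : k < d
  · have : k < d' := hk.trans_le h
    simp [euclPad, euclExtend, hk, this]
  · simp [euclPad, euclExtend, hk]

/-- The space `FM_∞(n)`: the increasing union of the spaces `FM_d(n)`. -/
def FMInf (n : ℕ) : Type :=
  {c : Coord (Fin n) (ℕ → ℝ) // ∃ (d : ℕ) (p : FM d n), mapDir euclPad p.1 = c}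

/-- The inclusion `FM_d(n) → FM_∞(n)`. -/
def FM.toInf {d n : ℕ} (p : FM d n) : FMInf n := ⟨mapDir euclPad p.1, d, p, rfl⟩

/-- `FM_∞(n)` carries the colimit topology. -/
instance (n : ℕ) : TopologicalSpace (FMInf n) :=
  ⨆ d : ℕ, TopologicalSpace.coinduced (FM.toInf (d := d) (n := n)) inferInstance

theorem FMInf.exists_of_le {n : ℕ} (x : FMInf n) :
    ∃ d, ∀ d', d ≤ d' → ∃ p : FM d' n, mapDir euclPad p.1 = x.1 := by
  obtain ⟨_, d, p, rfl⟩ := x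
  refine ⟨d, fun d' h => ⟨⟨mapDir (euclExtend h) p.1, mapDir_mem _ p.2⟩, ?_⟩⟩
  ext i j : 3
  · exact euclPad_extend h _
  · rfl

/-- Renaming of labels in `FM_∞`. -/
def FMInf.map {m n : ℕ} (σ : Fin m ≃ Fin n) (x : FMInf m) : FMInf n :=
  ⟨relabel σ x.1, by
    obtain ⟨_, d, p, rfl⟩ := x
    exact ⟨d, ⟨relabel σ p.1, relabel_mem σ p.2⟩, rfl⟩⟩

/-- Operadic composition in `FM_∞`. -/
def FMInf.comp {n : ℕ} (m : Fin n → ℕ) (x : FMInf n) (y : ∀ i, FMInf (m i)) :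
    FMInf (∑ i, m i) :=
  ⟨compFin m x.1 (fun i => (y i).1), by
    obtain ⟨d, hd⟩ := x.exists_of_le
    choose e he using fun i => (y i).exists_of_le
    obtain ⟨p, hp⟩ := hd (max d (Finset.univ.sup e)) (le_max_left _ _)
    choose q hq using fun i => he i (max d (Finset.univ.sup e))
      ((Finset.le_sup (Finset.mem_univ i)).trans (le_max_right _ _))
    refine ⟨_, ⟨compFin m p.1 (fun i => (q i).1), compFin_mem p.2 fun i => (q i).2⟩, ?_⟩
    simp only [mapDir_compFin, hp, hq]⟩

theorem FMInf.comp_map_right {n : ℕ} {m m' : Fin n → ℕ} (τ : ∀ i, Fin (m i) ≃ Fin (m' i))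
    (x : FMInf n) (y : ∀ i, FMInf (m i)) :
    FMInf.comp m' x (fun i => FMInf.map (τ i) (y i))
      = FMInf.map (blockSum τ) (FMInf.comp m x y) :=
  Subtype.ext (compFin_relabel_right τ x.1 (fun i => (y i).1))

/-! ## The classifying spaces `BU(1)` and `BO(1)` -/

/-- The infinite projective space `𝕜P^∞`, realized as the projectivization of the space of
polynomials: `BU(1)` for `𝕜 = ℂ` and `BO(1)` for `𝕜 = ℝ`. -/
def ProjInf (𝕜 : Type) [RCLike 𝕜] : Type := Projectivization 𝕜 𝕜[X]

namespace ProjInf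

variable {𝕜 : Type} [RCLike 𝕜]

/-- The class of a non-zero polynomial. -/
def mk (f : 𝕜[X]) (hf : f ≠ 0) : ProjInf 𝕜 := Projectivization.mk 𝕜 f hf

/-- The map from `𝕜^(n+1) ∖ {0}` to `𝕜P^∞` which sends `(a_0, …, a_n)` to the class of
`a_0 + a_1 t + ⋯ + a_n t^n`. -/
def ofCoeffs (n : ℕ) (a : {a : Fin (n + 1) → 𝕜 // a ≠ 0}) : ProjInf 𝕜 :=
  mk ((degreeLTEquiv 𝕜 (n + 1)).symm a.1 : 𝕜[X]) (by
    simpa using a.2)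

/-- `𝕜P^∞` is the colimit of the spaces `𝕜P^n`, and `𝕜P^n` is a quotient of
`𝕜^(n+1) ∖ {0}`. -/
instance : TopologicalSpace (ProjInf 𝕜) :=
  ⨆ n : ℕ, TopologicalSpace.coinduced (ofCoeffs (𝕜 := 𝕜) n) inferInstance

theorem mk_eq_mk_iff {f g : 𝕜[X]} (hf : f ≠ 0) (hg : g ≠ 0) :
    mk f hf = mk g hg ↔ ∃ a : 𝕜, a • g = f :=
  Projectivization.mk_eq_mk_iff' 𝕜 f g hf hg

theorem ind {P : ProjInf 𝕜 → Prop} (h : ∀ f hf, P (mk f hf)) (x : ProjInf 𝕜) : P x :=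
  Projectivization.ind (P := P) h x

/-- The product on `𝕜P^∞`, induced by multiplication of polynomials. -/
instance : Mul (ProjInf 𝕜) where
  mul x y := Projectivization.lift (K := 𝕜) (V := 𝕜[X])
    (fun f => Projectivization.lift (K := 𝕜) (V := 𝕜[X])
      (fun g => mk (f.1 * g.1) (mul_ne_zero f.2 g.2))
      (fun g g' t h => (mk_eq_mk_iff _ _).2 ⟨t, by rw [h]; simp⟩) y)
    (fun f f' t h => by
      induction y using ind with
      | h g hg => exact (mk_eq_mk_iff _ _).2 ⟨t, by rw [h]; simp⟩) x

theorem mk_mul_mk {f g : 𝕜[X]} (hf : f ≠ 0) (hg : g ≠ 0) :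
    mk f hf * mk g hg = mk (f * g) (mul_ne_zero hf hg) := rfl

instance : CommMonoid (ProjInf 𝕜) where
  one := mk 1 one_ne_zero
  mul_assoc x y z := by
    induction x using ind
    induction y using ind
    induction z using ind
    simp only [mk_mul_mk, mul_assoc]
  mul_comm x y := by
    induction x using ind
    induction y using ind
    simp only [mk_mul_mk, mul_comm]
  one_mul x := by
    induction x using ind with
    | h f hf =>
      change mk 1 one_ne_zero * mk f hf = mk f hf
      simp only [mk_mul_mk, one_mul]
  mul_one x := by
    induction x using ind with
    | h f hf =>
      change mk f hf * mk 1 one_ne_zero = mk f hf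
      simp only [mk_mul_mk, mul_one]

/-- The inclusion `𝕜P^1 → 𝕜P^∞`: a point `z ∈ 𝕜` is sent to the class of the linear polynomial
`t - z` with root `z`, and the point at infinity to the class of the constants (the unit). -/
def ofRoot (z : OnePoint 𝕜) : ProjInf 𝕜 :=
  z.elim 1 (fun a => mk (X - C a) (X_sub_C_ne_zero a))

end ProjInf

/-- Stereographic projection from the north pole `(0, 0, 1)` of the unit sphere in `ℝ³`. -/
def stereoComplex (u : EuclideanSpace ℝ (Fin 3)) : OnePoint ℂ :=
  if u 2 = 1 then OnePoint.infty
  else (((u 0 + u 1 * Complex.I) / (1 - u 2) : ℂ) : OnePoint ℂ)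

/-- Stereographic projection from the north pole `(0, 1)` of the unit circle in `ℝ²`. -/
def stereoReal (u : EuclideanSpace ℝ (Fin 2)) : OnePoint ℝ :=
  if u 1 = 1 then OnePoint.infty else ((u 0 / (1 - u 1) : ℝ) : OnePoint ℝ)

/-! ## Extended symmetric powers -/

/-- Two labelled elements of `FM_∞(n) × Bⁿ` are identified if they differ by the diagonal action
of a permutation. -/
def extSymSetoid (n : ℕ) (B : Type) : Setoid (FMInf n × (Fin n → B)) where
  r x y := ∃ σ : Fin n ≃ Fin n, y = (FMInf.map σ x.1, fun i => x.2 (σ.symm i))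
  iseqv :=
    { refl := fun x => ⟨Equiv.refl _, rfl⟩
      symm := by
        rintro x _ ⟨σ, rfl⟩
        refine ⟨σ.symm, Prod.ext (Subtype.ext ?_) ?_⟩
        · simp [FMInf.map, relabel]
        · simp
      trans := by
        rintro x _ _ ⟨σ, rfl⟩ ⟨τ, rfl⟩
        exact ⟨σ.trans τ, rfl⟩ }

/-- The extended symmetric power `D_n(B) = FM_∞(n) ×_{Σ_n} Bⁿ`. -/
def ExtSym (n : ℕ) (B : Type) : Type := Quotient (extSymSetoid n B)

instance (n : ℕ) (B : Type) [TopologicalSpace B] : TopologicalSpace (ExtSym n B) :=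
  inferInstanceAs (TopologicalSpace (Quotient (extSymSetoid n B)))

/-- `D(B)`, the disjoint union of all `D_n(B)`, `n ≥ 0`. -/
abbrev ExtSymTotal (B : Type) : Type := Σ n : ℕ, ExtSym n B

/-! ## Weighted Atiyah maps and the maps `ν` -/

section Nu

variable {d : ℕ} {B : Type} [CommMonoid B]

/-- The weighted Atiyah map `FM_d(n) → Bⁿ` with weights `w`, whose `i`-th component is
`∏_{j ≠ i} (x i j)^(w j)`; here `pt` is the map which regards a direction as an element of `B`. -/
def weightedAtiyah (pt : EuclideanSpace ℝ (Fin d) → B) {n : ℕ} (w : Fin n → ℕ) (p : FM d n)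
    (i : Fin n) : B :=
  ∏ j ∈ Finset.univ.erase i, pt (p.dir i j) ^ w j

/-- The label of the point `(i, j)` of the composite: the `i`-th component of the weighted Atiyah
map times the old label `j` in the `i`-th factor. -/
def nuLabel (pt : EuclideanSpace ℝ (Fin d) → B) {n : ℕ} (k : Fin n → ℕ) (p : FM d n)
    (y : ∀ i, FMInf (k i) × (Fin (k i) → B)) (s : Σ i, Fin (k i)) : B :=
  weightedAtiyah pt k p s.1 * (y s.1).2 s.2

/-- The map `ν` before passing to quotients by the symmetric groups. -/
def nuPre (pt : EuclideanSpace ℝ (Fin d) → B) {n : ℕ} (k : Fin n → ℕ) (p : FM d n)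
    (y : ∀ i, FMInf (k i) × (Fin (k i) → B)) :
    FMInf (∑ i, k i) × (Fin (∑ i, k i) → B) :=
  (FMInf.comp k p.toInf (fun i => (y i).1), fun a => nuLabel pt k p y (finSigmaFinEquiv.symm a))

theorem nuPre_congr (pt : EuclideanSpace ℝ (Fin d) → B) {n : ℕ} (k : Fin n → ℕ) (p : FM d n)
    (y y' : ∀ i, FMInf (k i) × (Fin (k i) → B)) (h : ∀ i, extSymSetoid (k i) B (y i) (y' i)) :
    extSymSetoid (∑ i, k i) B (nuPre pt k p y) (nuPre pt k p y') := by
  choose σ hσ using h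
  refine ⟨blockSum σ, Prod.ext ?_ ?_⟩
  · simp only [nuPre, hσ, FMInf.comp_map_right]
  · funext a
    obtain ⟨⟨i, j⟩, rfl⟩ := finSigmaFinEquiv.surjective a
    simp only [nuPre, blockSum_symm_apply, Equiv.symm_apply_apply]
    simp only [nuLabel, hσ]

/-- The map `ν : FM_d(n) × ∏ D_{k i}(B) → D_K(B)` with `K = ∑ k i`. -/
def nu (pt : EuclideanSpace ℝ (Fin d) → B) {n : ℕ} (k : Fin n → ℕ) (p : FM d n)
    (y : ∀ i, ExtSym (k i) B) : ExtSym (∑ i, k i) B :=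
  Quotient.finLiftOn (S := fun i => extSymSetoid (k i) B) y
    (fun z => Quotient.mk (extSymSetoid (∑ i, k i) B) (nuPre pt k p z))
    (fun z z' h => Quotient.sound (nuPre_congr pt k p z z' h))

/-- The maps `FM_d(n) × D(B)ⁿ → D(B)` assembled from the maps `ν` for all `k`. -/
def nuTotal (pt : EuclideanSpace ℝ (Fin d) → B) (n : ℕ) (p : FM d n)
    (y : Fin n → ExtSymTotal B) : ExtSymTotal B :=
  ⟨∑ i, (y i).1, nu pt (fun i => (y i).1) p (fun i => (y i).2)⟩

end Nu

/-- The space `BU(1) = ℂP^∞`. -/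
abbrev BU1 : Type := ProjInf ℂ

/-- The space `BO(1) = ℝP^∞`. -/
abbrev BO1 : Type := ProjInf ℝ

/-- The maps `ν` on `D(BU(1))`, built from directions in `S² ≅ ℂP¹ ⊆ BU(1)`. -/
def nuComplex : ∀ n : ℕ, FM 3 n → (Fin n → ExtSymTotal BU1) → ExtSymTotal BU1 :=
  nuTotal (fun u => ProjInf.ofRoot (stereoComplex u))

/-- The maps `ν` on `D(BO(1))`, built from directions in `S¹ ≅ ℝP¹ ⊆ BO(1)`. -/
def nuReal : ∀ n : ℕ, FM 2 n → (Fin n → ExtSymTotal BO1) → ExtSymTotal BO1 :=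
  nuTotal (fun u => ProjInf.ofRoot (stereoReal u))

end AtiyahFM

end

/-!
The maps `ν` satisfy the identities of an operad action before passing to quotients by the
symmetric groups, up to the canonical bijections between index sets of composed arities.  On the
points of `FM_∞` these are the identities of the Fulton–MacPherson operad.  On the labels the only
identity with content is a cocycle condition, `weightedAtiyah_comp`: in a composite configuration
all points of another block are seen from `(i, j)` in the same direction, so their contributions
multiply to the power whose exponent is the sum of their weights, and the remaining factors are
the Atiyah map of the block `i`.

Continuity is more delicate, because `FM_∞(n)` and `𝕜P^∞` carry colimit topologies while
all products carry the product topology.  The main tool is `IsSeqColimit.prod`: finite products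
commute with sequential colimits of locally compact spaces along injective maps.  It applies
directly to `FM_∞(n)`, the union of the locally compact spaces `FM_d(n)`, and yields the continuity
of the operadic composition.  For the product of `𝕜P^∞`, it is applied to the space of non-zero
polynomials, where multiplication is then continuous; the projection to `𝕜P^∞` is an open quotient
map, so its square is again a quotient map.  The quotient maps to the extended symmetric powers are
open for the same reason.  Finally, the map from the unit sphere to `𝕜P^∞` is continuous at the
north pole because the class of `(1 - s) t - a` is also that of `conj a • t - (1 + s)` when
`‖a‖² + s² = 1`.
-/

noncomputable section

namespace AtiyahFM

/-! ### Sequential colimits of locally compact spaces -/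

/-- The space `X` is the increasing union of the images of the injective maps `f n : K n → X`,
and carries the colimit topology.  The transition maps `K n → K (n + 1)` are only required to
exist; injectivity of `f (n + 1)` determines them. -/
structure IsSeqColimit {X : Type} [TopologicalSpace X] {K : ℕ → Type}
    [∀ n, TopologicalSpace (K n)] (f : ∀ n, K n → X) : Prop where
  continuous : ∀ n, Continuous (f n)
  injective : ∀ n, Function.Injective (f n)
  step : ∀ n, ∃ t : K n → K (n + 1), Continuous t ∧ ∀ a, f (n + 1) (t a) = f n a
  surjective : ∀ x, ∃ n a, f n a = x
  isOpen : ∀ U : Set X, (∀ n, IsOpen (f n ⁻¹' U)) → IsOpen U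

namespace IsSeqColimit

variable {X Y : Type} [TopologicalSpace X] [TopologicalSpace Y]
  {K L : ℕ → Type} [∀ n, TopologicalSpace (K n)] [∀ n, TopologicalSpace (L n)]
  {f : ∀ n, K n → X} {g : ∀ n, L n → Y}

theorem transition (h : IsSeqColimit f) {m n : ℕ} (hmn : m ≤ n) :
    ∃ t : K m → K n, Continuous t ∧ ∀ a, f n (t a) = f m a := by
  induction n, hmn using Nat.le_induction with
  | base => exact ⟨id, continuous_id, fun _ => rfl⟩
  | succ n _ ih =>
    obtain ⟨t, ht, h1⟩ := ih
    obtain ⟨s, hs, h2⟩ := h.step n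
    exact ⟨s ∘ t, hs.comp ht, fun a => by simp [h1, h2]⟩

theorem continuous_of_comp {Z : Type} [TopologicalSpace Z] (h : IsSeqColimit f) {φ : X → Z}
    (hφ : ∀ n, Continuous fun a => φ (f n a)) : Continuous φ :=
  ⟨fun _ hU => h.isOpen _ fun n => hU.preimage (hφ n)⟩

/-- A chain of subsets, each mapped into the interior of the next, has an open union. -/
theorem isOpen_iUnion_image (h : IsSeqColimit f) {N : ℕ} (A : ∀ k, Set (K (N + k)))
    (hA : ∀ k, ∀ a ∈ A k, ∃ b ∈ interior (A (k + 1)), f (N + (k + 1)) b = f (N + k) a) :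
    IsOpen (⋃ k, f (N + k) '' A k) := by
  have hA' : ∀ k, ∀ a ∈ A k, ∀ j,
      ∃ b ∈ interior (A (k + j + 1)), f (N + (k + j + 1)) b = f (N + k) a := by
    intro k a ha j
    induction j with
    | zero => exact hA k a ha
    | succ j ih =>
      obtain ⟨b, hb, e⟩ := ih
      obtain ⟨c, hc, e'⟩ := hA (k + j + 1) b (interior_subset hb)
      exact ⟨c, hc, e'.trans e⟩
  refine h.isOpen _ fun m => isOpen_iff_mem_nhds.2 fun z hz => ?_
  obtain ⟨k, a, ha, e⟩ := Set.mem_iUnion.1 hz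
  obtain ⟨b, hb, e'⟩ := hA' k a ha m
  obtain ⟨t, ht, e''⟩ := h.transition (m := m) (n := N + (k + m + 1)) (by omega)
  have htz : t z = b := h.injective _ (by rw [e'', e', e])
  refine mem_of_superset (ht.continuousAt.preimage_mem_nhds
    (isOpen_interior.mem_nhds (htz ▸ hb))) fun w hw => ?_
  exact Set.mem_iUnion.2 ⟨k + m + 1, t w, interior_subset hw, e'' w⟩

/-- The product of two sequential colimits of locally compact spaces, with the product topology,
is the colimit of the products.  An open neighbourhood inside a set which is open in the colimit
topology is built as the union of a chain of compact boxes, each in the interior of the next. -/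
theorem prod [∀ n, LocallyCompactSpace (K n)] [∀ n, LocallyCompactSpace (L n)]
    (hf : IsSeqColimit f) (hg : IsSeqColimit g) :
    IsSeqColimit (X := X × Y) (K := fun n => K n × L n) (fun n => Prod.map (f n) (g n)) where
  continuous n := (hf.continuous n).prodMap (hg.continuous n)
  injective n := (hf.injective n).prodMap (hg.injective n)
  step n := by
    obtain ⟨s, hs, hs'⟩ := hf.step n
    obtain ⟨t, ht, ht'⟩ := hg.step n
    exact ⟨Prod.map s t, hs.prodMap ht, fun a => Prod.ext (hs' _) (ht' _)⟩
  surjective := by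
    rintro ⟨x, y⟩
    obtain ⟨m, a, rfl⟩ := hf.surjective x
    obtain ⟨n, b, rfl⟩ := hg.surjective y
    obtain ⟨s, -, hs⟩ := hf.transition (le_max_left m n)
    obtain ⟨t, -, ht⟩ := hg.transition (le_max_right m n)
    exact ⟨max m n, (s a, t b), Prod.ext (hs a) (ht b)⟩
  isOpen W hW := by
    choose s hs hs' using hf.step
    choose t ht ht' using hg.step
    refine isOpen_iff_mem_nhds.2 ?_
    rintro ⟨x, y⟩ hxy
    obtain ⟨N, a, b, rfl, rfl⟩ : ∃ N a b, f N a = x ∧ g N b = y := by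
      obtain ⟨m, a, rfl⟩ := hf.surjective x
      obtain ⟨n, b, rfl⟩ := hg.surjective y
      obtain ⟨s, -, hs⟩ := hf.transition (le_max_left m n)
      obtain ⟨t, -, ht⟩ := hg.transition (le_max_right m n)
      exact ⟨max m n, s a, t b, hs a, ht b⟩
    let Box : ℕ → Type := fun k => {p : Set (K (N + k)) × Set (L (N + k)) //
      IsCompact p.1 ∧ IsCompact p.2 ∧ p.1 ×ˢ p.2 ⊆ Prod.map (f (N + k)) (g (N + k)) ⁻¹' W}
    have grow : ∀ k (p : Box k), ∃ q : Box (k + 1),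
        s (N + k) '' p.1.1 ⊆ interior q.1.1 ∧ t (N + k) '' p.1.2 ⊆ interior q.1.2 := by
      rintro k ⟨⟨A, B⟩, hA, hB, hAB⟩
      have hsub : (s (N + k) '' A) ×ˢ (t (N + k) '' B)
          ⊆ Prod.map (f (N + k + 1)) (g (N + k + 1)) ⁻¹' W := by
        rintro ⟨_, _⟩ ⟨⟨a, ha, rfl⟩, ⟨b, hb, rfl⟩⟩
        simpa [hs', ht'] using hAB (Set.mk_mem_prod ha hb)
      obtain ⟨U, V, hU, hV, hAU, hBV, hUV⟩ := generalized_tube_lemma (hA.image (hs _))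
        (hB.image (ht _)) (hW (N + k + 1)) hsub
      obtain ⟨A', hA', h1, h2⟩ := exists_compact_between (hA.image (hs _)) hU hAU
      obtain ⟨B', hB', h3, h4⟩ := exists_compact_between (hB.image (ht _)) hV hBV
      exact ⟨⟨(A', B'), hA', hB', (Set.prod_mono h2 h4).trans hUV⟩, h1, h3⟩
    choose next hn1 hn2 using grow
    let S : ∀ k, Box k := fun k => Nat.rec
      ⟨({a}, {b}), isCompact_singleton, isCompact_singleton, by simpa using hxy⟩ next k
    have hS1 : ∀ k, ∀ c ∈ (S k).1.1,
        ∃ c' ∈ interior (S (k + 1)).1.1, f (N + (k + 1)) c' = f (N + k) c :=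
      fun k c hc => ⟨s (N + k) c, hn1 k (S k) ⟨c, hc, rfl⟩, hs' _ _⟩
    have hS2 : ∀ k, ∀ c ∈ (S k).1.2,
        ∃ c' ∈ interior (S (k + 1)).1.2, g (N + (k + 1)) c' = g (N + k) c :=
      fun k c hc => ⟨t (N + k) c, hn2 k (S k) ⟨c, hc, rfl⟩, ht' _ _⟩
    have hU1 := hf.isOpen_iUnion_image (fun k => (S k).1.1) hS1
    have hU2 := hg.isOpen_iUnion_image (fun k => (S k).1.2) hS2
    have mono1 : Monotone fun k => f (N + k) '' (S k).1.1 := by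
      refine monotone_nat_of_le_succ fun k => ?_
      rintro _ ⟨c, hc, rfl⟩
      obtain ⟨c', h1, h2⟩ := hS1 k c hc
      exact ⟨c', interior_subset h1, h2⟩
    have mono2 : Monotone fun k => g (N + k) '' (S k).1.2 := by
      refine monotone_nat_of_le_succ fun k => ?_
      rintro _ ⟨c, hc, rfl⟩
      obtain ⟨c', h1, h2⟩ := hS2 k c hc
      exact ⟨c', interior_subset h1, h2⟩
    refine mem_of_superset (prod_mem_nhds
      (hU1.mem_nhds (Set.mem_iUnion.2 ⟨0, a, rfl, rfl⟩))
      (hU2.mem_nhds (Set.mem_iUnion.2 ⟨0, b, rfl, rfl⟩))) ?_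
    rintro ⟨x', y'⟩ ⟨hx, hy⟩
    obtain ⟨k, hk⟩ := Set.mem_iUnion.1 hx
    obtain ⟨l, hl⟩ := Set.mem_iUnion.1 hy
    obtain ⟨c, hc, rfl⟩ := mono1 (le_max_left k l) hk
    obtain ⟨c', hc', rfl⟩ := mono2 (le_max_right k l) hl
    exact (S (max k l)).2.2.2 (Set.mk_mem_prod hc hc')

theorem of_homeomorph (hf : IsSeqColimit f) (e : X ≃ₜ Y) (e' : ∀ n, K n ≃ₜ L n)
    (he : ∀ n a, g n (e' n a) = e (f n a)) : IsSeqColimit g := by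
  have hg : ∀ n, g n = e ∘ f n ∘ (e' n).symm := fun n => funext fun b => by
    obtain ⟨a, rfl⟩ := (e' n).surjective b
    simp [he]
  constructor
  · intro n
    rw [hg]
    exact e.continuous.comp ((hf.continuous n).comp (e' n).symm.continuous)
  · intro n
    rw [hg]
    exact e.injective.comp ((hf.injective n).comp (e' n).symm.injective)
  · intro n
    obtain ⟨t, ht, ht'⟩ := hf.step n
    exact ⟨e' (n + 1) ∘ t ∘ (e' n).symm,
      (e' (n + 1)).continuous.comp (ht.comp (e' n).symm.continuous), fun a => by simp [hg, ht']⟩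
  · intro y
    obtain ⟨n, a, ha⟩ := hf.surjective (e.symm y)
    exact ⟨n, e' n a, by rw [he, ha, e.apply_symm_apply]⟩
  · intro U hU
    rw [← e.isOpen_preimage]
    refine hf.isOpen _ fun n => ?_
    have : f n ⁻¹' (e ⁻¹' U) = e' n ⁻¹' (g n ⁻¹' U) := by ext a; simp [he]
    rw [this]
    exact (hU n).preimage (e' n).continuous

/-- The homeomorphism which splits off the first factor of a finite product. -/
def consHomeomorph {m : ℕ} (Z : Fin (m + 1) → Type) [∀ i, TopologicalSpace (Z i)] :
    (Z 0 × ∀ i : Fin m, Z i.succ) ≃ₜ ∀ i, Z i where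
  toEquiv := Fin.consEquiv Z
  continuous_toFun := continuous_pi fun i => by
    induction i using Fin.cases with
    | zero => exact continuous_fst
    | succ i => exact (continuous_apply i).comp continuous_snd
  continuous_invFun := (continuous_apply 0).prodMk
    (continuous_pi fun i => continuous_apply i.succ)

theorem pi {m : ℕ} {Z : Fin m → Type} [∀ i, TopologicalSpace (Z i)] {M : Fin m → ℕ → Type}
    [∀ i n, TopologicalSpace (M i n)] [∀ i n, LocallyCompactSpace (M i n)]
    {φ : ∀ i n, M i n → Z i} (h : ∀ i, IsSeqColimit (φ i)) :
    IsSeqColimit (X := ∀ i, Z i) (K := fun n => ∀ i, M i n) (fun n z i => φ i n (z i)) := by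
  induction m with
  | zero =>
    exact
      { continuous := fun n => continuous_of_const fun _ _ => Subsingleton.elim _ _
        injective := fun n => Function.injective_of_subsingleton _
        step := fun n => ⟨fun _ i => i.elim0, continuous_of_const fun _ _ => rfl,
          fun _ => Subsingleton.elim _ _⟩
        surjective := fun x => ⟨0, fun i => i.elim0, Subsingleton.elim _ _⟩
        isOpen := fun U _ => isOpen_discrete U }
  | succ m ih =>
    refine ((h 0).prod (ih fun i => h i.succ)).of_homeomorph (consHomeomorph Z)
      (fun n => consHomeomorph fun i => M i n) fun n a => funext fun i => ?_
    induction i using Fin.cases <;> rfl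

end IsSeqColimit

/-! ### Topology of the Fulton–MacPherson spaces -/

theorem FM.continuous_dir {d n : ℕ} (i j : Fin n) : Continuous fun p : FM d n => p.dir i j := by
  have : Continuous fun c : Coord (Fin n) (EuclideanSpace ℝ (Fin d)) => c.1 i j := by fun_prop
  exact this.comp continuous_subtype_val

theorem FM.norm_dir {d n : ℕ} (p : FM d n) {i j : Fin n} (h : j ≠ i) : ‖p.dir i j‖ = 1 := by
  have hcl : IsClosed {c : Coord (Fin n) (EuclideanSpace ℝ (Fin d)) | ‖c.1 i j‖ = 1} :=
    isClosed_eq (by fun_prop) continuous_const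
  refine closure_minimal ?_ hcl p.2
  rintro _ ⟨x, hx, rfl⟩
  have h0 : ‖x j - x i‖ ≠ 0 := norm_ne_zero_iff.2 (sub_ne_zero.2 fun e => h (hx e))
  simp [configCoord, norm_smul, h0]

instance (d n : ℕ) : LocallyCompactSpace (FM d n) :=
  (isClosed_closure.isClosedEmbedding_subtypeVal :
    IsClosedEmbedding (Subtype.val : fmSet (Fin n) (EuclideanSpace ℝ (Fin d)) → _))
    |>.locallyCompactSpace

/-- The map `FM_d(n) → FM_d'(n)` for `d ≤ d'`. -/
def FM.extend {d d' n : ℕ} (h : d ≤ d') (p : FM d n) : FM d' n :=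
  ⟨mapDir (euclExtend h) p.1, mapDir_mem _ p.2⟩

theorem FM.continuous_extend {d d' n : ℕ} (h : d ≤ d') :
    Continuous (FM.extend h : FM d n → FM d' n) := by
  have h' : Continuous (euclExtend h) := (euclExtend h).continuous
  have : Continuous (mapDir (I := Fin n) (euclExtend h)) := by unfold mapDir; fun_prop
  exact (this.comp continuous_subtype_val).subtype_mk _

theorem FM.toInf_extend {d d' n : ℕ} (h : d ≤ d') (p : FM d n) :
    (FM.extend h p).toInf = p.toInf := by
  refine Subtype.ext (Prod.ext (funext fun i => funext fun j => ?_) rfl)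
  exact euclPad_extend h _

theorem euclPad_injective {d : ℕ} : Function.Injective (euclPad (d := d)) := by
  intro v w h
  ext k
  simpa [euclPad] using congrFun h k

theorem FM.toInf_injective {d n : ℕ} : Function.Injective (FM.toInf : FM d n → FMInf n) := by
  intro p q h
  have h' : mapDir euclPad p.1 = mapDir euclPad q.1 := congrArg Subtype.val h
  refine Subtype.ext (Prod.ext (funext fun i => funext fun j => ?_) (congrArg Prod.snd h' :))
  exact euclPad_injective (congrFun (congrFun (congrArg Prod.fst h') i) j)

theorem FM.continuous_toInf {d n : ℕ} : Continuous (FM.toInf : FM d n → FMInf n) :=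
  continuous_iSup_rng (i := d) continuous_coinduced_rng

theorem FMInf.isSeqColimit (n : ℕ) :
    IsSeqColimit (fun d => (FM.toInf : FM d n → FMInf n)) where
  continuous _ := FM.continuous_toInf
  injective _ := FM.toInf_injective
  step d := ⟨FM.extend d.le_succ, FM.continuous_extend _, FM.toInf_extend _⟩
  surjective := by
    rintro ⟨_, d, p, rfl⟩
    exact ⟨d, p, rfl⟩
  isOpen _ hU := isOpen_iSup_iff.2 fun d => isOpen_coinduced.2 (hU d)

theorem FMInf.continuous_map {m n : ℕ} (σ : Fin m ≃ Fin n) : Continuous (FMInf.map σ) :=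
  (FMInf.isSeqColimit m).continuous_of_comp fun d => by
    have : (fun p : FM d m => FMInf.map σ p.toInf) = FM.toInf ∘ FM.map σ := rfl
    rw [this]
    exact FM.continuous_toInf.comp ((fultonMacPherson d).continuous_map σ)

theorem FM.toInf_comp {d n : ℕ} (m : Fin n → ℕ) (p : FM d n) (q : ∀ i, FM d (m i)) :
    (FM.comp m p q).toInf = FMInf.comp m p.toInf fun i => (q i).toInf :=
  Subtype.ext (mapDir_compFin _ _ _)

theorem FMInf.continuous_comp {n : ℕ} (m : Fin n → ℕ) :
    Continuous fun x : FMInf n × (∀ i, FMInf (m i)) => FMInf.comp m x.1 x.2 :=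
  ((FMInf.isSeqColimit n).prod
    (IsSeqColimit.pi fun i => FMInf.isSeqColimit (m i))).continuous_of_comp fun d => by
    have : (fun x : FM d n × (∀ i, FM d (m i)) =>
        FMInf.comp m x.1.toInf fun i => (x.2 i).toInf)
        = FM.toInf ∘ fun x => FM.comp m x.1 x.2 :=
      funext fun x => (FM.toInf_comp m x.1 x.2).symm
    exact this ▸ FM.continuous_toInf.comp ((fultonMacPherson d).continuous_comp m)

/-! ### Topology of the infinite projective space -/

section ProjInf

variable {𝕜 : Type} [RCLike 𝕜]

/-- The space of non-zero polynomials, with the topology of the colimit of `𝕜^(n+1) ∖ {0}`. -/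
def NonzeroPoly (𝕜 : Type) [RCLike 𝕜] : Type := {f : 𝕜[X] // f ≠ 0}

namespace NonzeroPoly

/-- The polynomial `a_0 + a_1 t + ⋯ + a_n t^n`. -/
def ofCoeffs (n : ℕ) (a : {a : Fin (n + 1) → 𝕜 // a ≠ 0}) : NonzeroPoly 𝕜 :=
  ⟨((degreeLTEquiv 𝕜 (n + 1)).symm a.1 : 𝕜[X]), by simpa using a.2⟩

instance : TopologicalSpace (NonzeroPoly 𝕜) :=
  ⨆ n : ℕ, TopologicalSpace.coinduced (ofCoeffs (𝕜 := 𝕜) n) inferInstance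

theorem continuous_ofCoeffs (n : ℕ) : Continuous (ofCoeffs (𝕜 := 𝕜) n) :=
  continuous_iSup_rng (i := n) continuous_coinduced_rng

theorem coeff_ofCoeffs (n : ℕ) (a : {a : Fin (n + 1) → 𝕜 // a ≠ 0}) (k : ℕ) :
    (ofCoeffs n a).1.coeff k = if h : k < n + 1 then a.1 ⟨k, h⟩ else 0 := by
  split_ifs with h
  · have := congrFun ((degreeLTEquiv 𝕜 (n + 1)).apply_symm_apply a.1) ⟨k, h⟩
    exact this
  · refine coeff_eq_zero_of_degree_lt ?_
    have := mem_degreeLT.1 ((degreeLTEquiv 𝕜 (n + 1)).symm a.1).2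
    exact this.trans_le (by exact_mod_cast not_lt.1 h)

theorem continuous_coeff_ofCoeffs (n k : ℕ) :
    Continuous fun a : {a : Fin (n + 1) → 𝕜 // a ≠ 0} => (ofCoeffs n a).1.coeff k := by
  simp only [coeff_ofCoeffs]
  split_ifs with h
  · exact (continuous_apply _).comp continuous_subtype_val
  · exact continuous_const

theorem ofCoeffs_injective (n : ℕ) : Function.Injective (ofCoeffs (𝕜 := 𝕜) n) := by
  intro a b h
  refine Subtype.ext (funext fun k => ?_)
  have := congrArg (fun f : NonzeroPoly 𝕜 => f.1.coeff k) h
  simpa only [coeff_ofCoeffs, dif_pos k.2] using this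

/-- The first `n + 1` coefficients of a polynomial of degree at most `n`. -/
def coeffs (n : ℕ) (f : NonzeroPoly 𝕜) (hf : f.1.natDegree ≤ n) :
    {a : Fin (n + 1) → 𝕜 // a ≠ 0} :=
  ⟨fun k => f.1.coeff k, fun h => f.2 (Polynomial.ext fun k => by
    by_cases hk : k < n + 1
    · exact congrFun h ⟨k, hk⟩
    · exact coeff_eq_zero_of_natDegree_lt (by omega))⟩

theorem ofCoeffs_coeffs (n : ℕ) (f : NonzeroPoly 𝕜) (hf : f.1.natDegree ≤ n) :
    ofCoeffs n (coeffs n f hf) = f := by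
  refine Subtype.ext (Polynomial.ext fun k => ?_)
  rw [coeff_ofCoeffs]
  split_ifs with hk
  · rfl
  · exact (coeff_eq_zero_of_natDegree_lt (by omega)).symm

/-- A family of polynomials of bounded degree is continuous if its coefficients are. -/
theorem continuous_of_coeff {Z : Type} [TopologicalSpace Z] {φ : Z → NonzeroPoly 𝕜} (n : ℕ)
    (hn : ∀ z, (φ z).1.natDegree ≤ n) (h : ∀ k, Continuous fun z => (φ z).1.coeff k) :
    Continuous φ := by
  have : φ = ofCoeffs n ∘ fun z => coeffs n (φ z) (hn z) :=
    funext fun z => (ofCoeffs_coeffs n _ _).symm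
  rw [this]
  exact (continuous_ofCoeffs n).comp
    (Continuous.subtype_mk (continuous_pi fun k : Fin (n + 1) => h k) _)

theorem natDegree_ofCoeffs (n : ℕ) (a : {a : Fin (n + 1) → 𝕜 // a ≠ 0}) :
    (ofCoeffs n a).1.natDegree ≤ n :=
  natDegree_le_iff_coeff_eq_zero.2 fun k hk => by
    rw [coeff_ofCoeffs, dif_neg (by omega)]

theorem isSeqColimit : IsSeqColimit (ofCoeffs (𝕜 := 𝕜)) where
  continuous := continuous_ofCoeffs
  injective := ofCoeffs_injective
  step n := ⟨fun a => coeffs (n + 1) (ofCoeffs n a) ((natDegree_ofCoeffs n a).trans n.le_succ),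
    Continuous.subtype_mk (continuous_pi fun k : Fin (n + 2) => continuous_coeff_ofCoeffs n k) _,
    fun _ => ofCoeffs_coeffs _ _ _⟩
  surjective f := ⟨_, coeffs f.1.natDegree f le_rfl, ofCoeffs_coeffs _ _ _⟩
  isOpen _ hU := isOpen_iSup_iff.2 fun n => isOpen_coinduced.2 (hU n)

instance (n : ℕ) : LocallyCompactSpace {a : Fin (n + 1) → 𝕜 // a ≠ 0} :=
  (isOpen_ne : IsOpen {a : Fin (n + 1) → 𝕜 | a ≠ 0}).locallyCompactSpace

/-- The product of non-zero polynomials. -/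
def mul (x : NonzeroPoly 𝕜 × NonzeroPoly 𝕜) : NonzeroPoly 𝕜 :=
  ⟨x.1.1 * x.2.1, mul_ne_zero x.1.2 x.2.2⟩

theorem continuous_mul : Continuous (mul (𝕜 := 𝕜)) :=
  (isSeqColimit.prod isSeqColimit).continuous_of_comp fun n => by
    refine continuous_of_coeff (n + n) (fun a => ?_) fun k => ?_
    · exact natDegree_mul_le.trans
        (add_le_add (natDegree_ofCoeffs n a.1) (natDegree_ofCoeffs n a.2))
    · simp only [mul, Prod.map, coeff_mul]
      exact continuous_finsetSum _ fun i _ =>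
        ((continuous_coeff_ofCoeffs n i.1).comp continuous_fst).mul
          ((continuous_coeff_ofCoeffs n i.2).comp continuous_snd)

/-- Multiplication by a non-zero scalar. -/
def smul (c : 𝕜ˣ) (f : NonzeroPoly 𝕜) : NonzeroPoly 𝕜 :=
  ⟨C (c : 𝕜) * f.1, mul_ne_zero (C_ne_zero.2 c.ne_zero) f.2⟩

theorem continuous_smul (c : 𝕜ˣ) : Continuous (smul c) :=
  isSeqColimit.continuous_of_comp fun n => by
    refine continuous_of_coeff n (fun a => ?_) fun k => ?_
    · exact (natDegree_C_mul_le _ _).trans (natDegree_ofCoeffs n a)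
    · simp only [smul, coeff_C_mul]
      exact continuous_const.mul (continuous_coeff_ofCoeffs n k)

/-- The class of a non-zero polynomial in `𝕜P^∞`. -/
def toProj (f : NonzeroPoly 𝕜) : ProjInf 𝕜 := ProjInf.mk f.1 f.2

theorem isQuotientMap_toProj : IsQuotientMap (toProj (𝕜 := 𝕜)) := by
  refine ⟨⟨?_⟩, fun x => ?_⟩
  · change (⨆ n : ℕ, TopologicalSpace.coinduced (ProjInf.ofCoeffs (𝕜 := 𝕜) n) inferInstance)
      = TopologicalSpace.coinduced toProj (⨆ n : ℕ, _)
    rw [coinduced_iSup]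
    simp only [coinduced_compose]
    rfl
  · induction x using ProjInf.ind with
    | h f hf => exact ⟨⟨f, hf⟩, rfl⟩

theorem toProj_eq_iff {f g : NonzeroPoly 𝕜} : toProj f = toProj g ↔ ∃ c : 𝕜ˣ, smul c g = f := by
  rw [toProj, toProj, ProjInf.mk_eq_mk_iff]
  constructor
  · rintro ⟨a, ha⟩
    have h0 : a ≠ 0 := by
      rintro rfl
      exact f.2 (by rw [← ha, zero_smul])
    exact ⟨Units.mk0 a h0, Subtype.ext ((smul_eq_C_mul a).symm.trans ha)⟩
  · rintro ⟨c, rfl⟩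
    exact ⟨c, smul_eq_C_mul _⟩

/-- The fibres are orbits of a group of homeomorphisms, so the quotient map is open.  This makes
its square a quotient map. -/
theorem isOpenQuotientMap_toProj : IsOpenQuotientMap (toProj (𝕜 := 𝕜)) := by
  refine ⟨isQuotientMap_toProj.surjective, isQuotientMap_toProj.continuous, fun U hU => ?_⟩
  rw [← isQuotientMap_toProj.isOpen_preimage]
  have : toProj ⁻¹' (toProj '' U) = ⋃ c : 𝕜ˣ, smul c ⁻¹' U := by
    ext f
    simp only [Set.mem_preimage, Set.mem_image, Set.mem_iUnion, toProj_eq_iff]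
    constructor
    · rintro ⟨g, hg, c, rfl⟩
      exact ⟨c, hg⟩
    · rintro ⟨c, hc⟩
      exact ⟨_, hc, c, rfl⟩
  rw [this]
  exact isOpen_iUnion fun c => hU.preimage (continuous_smul c)

end NonzeroPoly

instance : ContinuousMul (ProjInf 𝕜) where
  continuous_mul := by
    have h := NonzeroPoly.isOpenQuotientMap_toProj (𝕜 := 𝕜)
    rw [← (h.prodMap h).continuous_comp_iff]
    exact h.continuous.comp NonzeroPoly.continuous_mul

/-- The point of `𝕜P¹ ⊆ 𝕜P^∞` which corresponds to the point `(a, s)` of the unit sphere of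
`𝕜 × ℝ` under stereographic projection from `(0, 1)`. -/
def ProjInf.ofSphere (a : 𝕜) (s : ℝ) : ProjInf 𝕜 :=
  if s = 1 then 1 else ofRoot ((a / (1 - s : ℝ) : 𝕜) : OnePoint 𝕜)

theorem ProjInf.ofSphere_eq_south {a : 𝕜} {s : ℝ} (hs : s ≠ 1)
    (hf : C ((1 - s : ℝ) : 𝕜) * X - C a ≠ 0) :
    ofSphere a s = mk (C ((1 - s : ℝ) : 𝕜) * X - C a) hf := by
  have h0 : ((1 - s : ℝ) : 𝕜) ≠ 0 := by
    rw [Ne, RCLike.ofReal_eq_zero, sub_eq_zero]; exact hs.symm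
  rw [ofSphere, if_neg hs]
  refine (mk_eq_mk_iff _ _).2 ⟨((1 - s : ℝ) : 𝕜)⁻¹, ?_⟩
  rw [smul_eq_C_mul, mul_sub, ← mul_assoc, ← C_mul, ← C_mul, inv_mul_cancel₀ h0, C_1, one_mul,
    inv_mul_eq_div]

/-- Near the north pole, the linear polynomial `(1 - s) t - a` is replaced by its multiple
`conj a • t - (1 + s)`. -/
theorem ProjInf.ofSphere_eq_north {a : 𝕜} {s : ℝ} (h : ‖a‖ ^ 2 + s ^ 2 = 1) (hs : s ≠ -1)
    (hf : C (starRingEnd 𝕜 a) * X - C ((1 + s : ℝ) : 𝕜) ≠ 0) :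
    ofSphere a s = mk (C (starRingEnd 𝕜 a) * X - C ((1 + s : ℝ) : 𝕜)) hf := by
  have h0 : ((1 + s : ℝ) : 𝕜) ≠ 0 := by
    rw [Ne, RCLike.ofReal_eq_zero]; intro e; exact hs (by linarith)
  by_cases hs1 : s = 1
  · subst hs1
    have ha : a = 0 := by simpa using h
    subst ha
    rw [ofSphere, if_pos rfl]
    refine (mk_eq_mk_iff _ _).2 ⟨-((1 + 1 : ℝ) : 𝕜)⁻¹, ?_⟩
    rw [map_zero, C_0, zero_mul, zero_sub, smul_eq_C_mul, C_neg, neg_mul_neg, ← C_mul,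
      inv_mul_cancel₀ h0, C_1]
  · have h1 : ((1 - s : ℝ) : 𝕜) ≠ 0 := by
      rw [Ne, RCLike.ofReal_eq_zero, sub_eq_zero]; exact fun e => hs1 e.symm
    have ha : starRingEnd 𝕜 a ≠ 0 := by
      rw [Ne, map_eq_zero]
      rintro rfl
      have : (s - 1) * (s + 1) = 0 := by rw [norm_zero] at h; linarith
      rcases mul_eq_zero.1 this with h' | h'
      · exact hs1 (by linarith)
      · exact hs (by linarith)
    rw [ofSphere, if_neg hs1]
    refine (mk_eq_mk_iff _ _).2 ⟨(starRingEnd 𝕜 a)⁻¹, ?_⟩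
    have key : (starRingEnd 𝕜 a)⁻¹ * ((1 + s : ℝ) : 𝕜) = a / ((1 - s : ℝ) : 𝕜) := by
      rw [eq_div_iff h1, mul_assoc, inv_mul_eq_iff_eq_mul₀ ha, RCLike.conj_mul,
        ← RCLike.ofReal_mul, ← RCLike.ofReal_pow]
      congr 1
      linarith
    rw [smul_eq_C_mul, mul_sub, ← mul_assoc, ← C_mul, ← C_mul, inv_mul_cancel₀ ha, C_1, one_mul,
      key]

theorem ProjInf.continuous_mk_linear {Z : Type} [TopologicalSpace Z] {a b : Z → 𝕜}
    (ha : Continuous a) (hb : Continuous b) (h : ∀ z, C (a z) * X - C (b z) ≠ 0) :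
    Continuous fun z => mk (C (a z) * X - C (b z)) (h z) := by
  have : Continuous fun z => show NonzeroPoly 𝕜 from ⟨C (a z) * X - C (b z), h z⟩ := by
    refine NonzeroPoly.continuous_of_coeff 1 (fun z => ?_) fun k => ?_
    · change (C (a z) * X - C (b z)).natDegree ≤ 1
      compute_degree
    · simp only [coeff_sub, coeff_C_mul, coeff_X, coeff_C]
      split_ifs <;> fun_prop
  exact NonzeroPoly.isQuotientMap_toProj.continuous.comp this

theorem ProjInf.linear_ne_zero_left {a b : 𝕜} (ha : a ≠ 0) : C a * X - C b ≠ 0 := fun h =>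
  ha (by simpa [coeff_X, coeff_C] using congrArg (fun f => f.coeff 1) h)

theorem ProjInf.linear_ne_zero_right {a b : 𝕜} (hb : b ≠ 0) : C a * X - C b ≠ 0 := fun h =>
  hb (by simpa [coeff_X, coeff_C] using congrArg (fun f => f.coeff 0) h)

theorem ProjInf.continuousOn_ofSphere :
    ContinuousOn (fun z : 𝕜 × ℝ => ofSphere z.1 z.2) {z | ‖z.1‖ ^ 2 + z.2 ^ 2 = 1} := by
  rw [continuousOn_iff_continuous_domRestrict, continuous_iff_continuousAt]
  set S : Set (𝕜 × ℝ) := {z | ‖z.1‖ ^ 2 + z.2 ^ 2 = 1}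
  have h1 : Continuous fun z : S => z.1.1 := by fun_prop
  have h2 : Continuous fun z : S => z.1.2 := by fun_prop
  intro z
  by_cases hz : z.1.2 = 1
  · have hU : IsOpen {z : S | z.1.2 ≠ -1} := isOpen_ne_fun h2 continuous_const
    refine ContinuousOn.continuousAt ?_ (hU.mem_nhds (by
      rw [Set.mem_ofPred_eq, hz]; norm_num))
    rw [continuousOn_iff_continuous_domRestrict]
    have hf : ∀ w : {z : S | z.1.2 ≠ -1},
        C (starRingEnd 𝕜 w.1.1.1) * X - C ((1 + w.1.1.2 : ℝ) : 𝕜) ≠ 0 := fun w =>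
      linear_ne_zero_right (by
        rw [Ne, RCLike.ofReal_eq_zero]; intro e; exact w.2 (by linarith))
    refine (continuous_mk_linear (RCLike.continuous_conj.comp (h1.comp continuous_subtype_val))
      (RCLike.continuous_ofReal.comp (continuous_const.add (h2.comp continuous_subtype_val)))
      hf).congr fun w => ?_
    exact (ofSphere_eq_north w.1.2 w.2 (hf w)).symm
  · have hU : IsOpen {z : S | z.1.2 ≠ 1} := isOpen_ne_fun h2 continuous_const
    refine ContinuousOn.continuousAt ?_ (hU.mem_nhds hz)
    rw [continuousOn_iff_continuous_domRestrict]
    have hf : ∀ w : {z : S | z.1.2 ≠ 1},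
        C ((1 - w.1.1.2 : ℝ) : 𝕜) * X - C w.1.1.1 ≠ 0 := fun w =>
      linear_ne_zero_left (by
        rw [Ne, RCLike.ofReal_eq_zero]; intro e; exact w.2 (by linarith))
    refine (continuous_mk_linear
      (RCLike.continuous_ofReal.comp (continuous_const.sub (h2.comp continuous_subtype_val)))
      (h1.comp continuous_subtype_val) hf).congr fun w => ?_
    exact (ofSphere_eq_south w.2 (hf w)).symm

theorem continuousOn_ofRoot_stereoComplex :
    ContinuousOn (fun u => ProjInf.ofRoot (stereoComplex u)) {u | ‖u‖ = 1} := by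
  have h : Continuous fun u : EuclideanSpace ℝ (Fin 3) =>
      ((u 0 + u 1 * Complex.I, u 2) : ℂ × ℝ) := by fun_prop
  have hm : Set.MapsTo (fun u : EuclideanSpace ℝ (Fin 3) =>
      ((u 0 + u 1 * Complex.I, u 2) : ℂ × ℝ)) {u | ‖u‖ = 1} {z | ‖z.1‖ ^ 2 + z.2 ^ 2 = 1} := by
    intro u hu
    have hu' : ‖u‖ ^ 2 = 1 := by rw [show ‖u‖ = 1 from hu, one_pow]
    rw [EuclideanSpace.real_norm_sq_eq, Fin.sum_univ_three] at hu'
    rw [Set.mem_ofPred_eq, ← Complex.normSq_eq_norm_sq, Complex.normSq_add_mul_I]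
    exact hu'
  refine (ProjInf.continuousOn_ofSphere.comp h.continuousOn hm).congr fun u _ => ?_
  simp only [stereoComplex, ProjInf.ofSphere, Function.comp]
  split_ifs
  · rfl
  · simp

theorem continuousOn_ofRoot_stereoReal :
    ContinuousOn (fun u => ProjInf.ofRoot (stereoReal u)) {u | ‖u‖ = 1} := by
  have h : Continuous fun u : EuclideanSpace ℝ (Fin 2) => ((u 0, u 1) : ℝ × ℝ) := by fun_prop
  have hm : Set.MapsTo (fun u : EuclideanSpace ℝ (Fin 2) => ((u 0, u 1) : ℝ × ℝ))
      {u | ‖u‖ = 1} {z | ‖z.1‖ ^ 2 + z.2 ^ 2 = 1} := by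
    intro u hu
    have hu' : ‖u‖ ^ 2 = 1 := by rw [show ‖u‖ = 1 from hu, one_pow]
    rw [EuclideanSpace.real_norm_sq_eq, Fin.sum_univ_two] at hu'
    rw [Set.mem_ofPred_eq, Real.norm_eq_abs, sq_abs]
    exact hu'
  refine (ProjInf.continuousOn_ofSphere.comp h.continuousOn hm).congr fun u _ => ?_
  simp only [stereoReal, ProjInf.ofSphere, Function.comp]
  split_ifs
  · rfl
  · simp

end ProjInf

/-! ### Extended symmetric powers -/

section ExtSym

variable {B : Type}

/-- The point of `D(B)` represented by a labelled element of `FM_∞(k)`. -/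
def ExtSymTotal.mk (k : ℕ) (x : FMInf k × (Fin k → B)) : ExtSymTotal B :=
  ⟨k, Quotient.mk (extSymSetoid k B) x⟩

theorem ExtSymTotal.exists_rep {n : ℕ} (y : Fin n → ExtSymTotal B) :
    ∃ (k : Fin n → ℕ) (x : ∀ i, FMInf (k i) × (Fin (k i) → B)),
      y = fun i => ExtSymTotal.mk (k i) (x i) := by
  choose x hx using fun i => Quotient.exists_rep (y i).2
  exact ⟨fun i => (y i).1, x, funext fun i => Sigma.ext rfl (heq_of_eq (hx i).symm)⟩

/-- Equality in `D(B)` may be checked along a bijection between index sets `Fin m` and `Fin n`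
which are not syntactically equal. -/
theorem ExtSymTotal.mk_eq_mk {m n : ℕ} {x : FMInf m × (Fin m → B)} {y : FMInf n × (Fin n → B)}
    (σ : Fin m ≃ Fin n) (h1 : y.1 = FMInf.map σ x.1) (h2 : ∀ i, y.2 i = x.2 (σ.symm i)) :
    ExtSymTotal.mk m x = ExtSymTotal.mk n y := by
  obtain rfl : m = n := by simpa using Fintype.card_congr σ
  exact Sigma.ext rfl (heq_of_eq (Quotient.sound ⟨σ, Prod.ext h1 (funext h2)⟩))

variable [TopologicalSpace B]

theorem ExtSymTotal.continuous_mk (k : ℕ) : Continuous (ExtSymTotal.mk (B := B) k) :=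
  continuous_sigmaMk.comp continuous_quot_mk

/-- The quotient by the symmetric group is an open map, since the group acts by
homeomorphisms. -/
theorem ExtSymTotal.isOpenMap_mk (k : ℕ) : IsOpenMap (ExtSymTotal.mk (B := B) k) := by
  suffices h : IsOpenMap (Quotient.mk (extSymSetoid k B)) from
    (isOpenMap_sigmaMk (σ := fun k => ExtSym k B) (i := k)).comp h
  intro U hU
  have hq : IsQuotientMap (Quotient.mk (extSymSetoid k B)) := isQuotientMap_quot_mk
  rw [← hq.isOpen_preimage]
  have : Quotient.mk (extSymSetoid k B) ⁻¹' (Quotient.mk (extSymSetoid k B) '' U)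
      = ⋃ σ : Fin k ≃ Fin k, (fun x : FMInf k × (Fin k → B) =>
          (FMInf.map σ x.1, fun i => x.2 (σ.symm i))) ⁻¹' U := by
    ext x
    simp only [Set.mem_preimage, Set.mem_image, Set.mem_iUnion]
    constructor
    · rintro ⟨z, hz, e⟩
      obtain ⟨σ, rfl⟩ := Quotient.exact e.symm
      exact ⟨σ, hz⟩
    · rintro ⟨σ, hσ⟩
      exact ⟨_, hσ, (Quotient.sound (s := extSymSetoid k B) ⟨σ, rfl⟩).symm⟩
  rw [this]
  refine isOpen_iUnion fun σ => hU.preimage ?_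
  exact ((FMInf.continuous_map σ).comp continuous_fst).prodMk (by fun_prop)

end ExtSym

/-! ### Weighted Atiyah maps -/

section Atiyah

variable {d : ℕ} {B : Type} [CommMonoid B] (pt : EuclideanSpace ℝ (Fin d) → B)

theorem weightedAtiyah_eq_prod_ite {n : ℕ} (w : Fin n → ℕ) (p : FM d n) (i : Fin n) :
    weightedAtiyah pt w p i = ∏ j, if j = i then 1 else pt (p.dir i j) ^ w j := by
  rw [weightedAtiyah, ← Finset.mul_prod_erase Finset.univ _ (Finset.mem_univ i), if_pos rfl,
    one_mul]
  exact Finset.prod_congr rfl fun j hj => (if_neg (Finset.ne_of_mem_erase hj)).symm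

theorem weightedAtiyah_fin_one (w : Fin 1 → ℕ) (p : FM d 1) (i : Fin 1) :
    weightedAtiyah pt w p i = 1 := by
  rw [weightedAtiyah_eq_prod_ite]
  exact Finset.prod_eq_one fun j _ => if_pos (Subsingleton.elim _ _)

theorem weightedAtiyah_map {m n : ℕ} (σ : Fin m ≃ Fin n) (w : Fin n → ℕ) (p : FM d m)
    (i : Fin m) :
    weightedAtiyah pt w (FM.map σ p) (σ i) = weightedAtiyah pt (fun i => w (σ i)) p i := by
  rw [weightedAtiyah_eq_prod_ite, weightedAtiyah_eq_prod_ite, ← σ.prod_comp]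
  simp only [σ.injective.eq_iff, FM.dir, FM.map, relabel, σ.symm_apply_apply]

/-- The cocycle identity for the Atiyah maps.  Seen from a point of the block `i`, all the points
of another block lie in the same direction, so that their weights add up; the points of the block
`i` itself contribute the Atiyah map of that block. -/
theorem weightedAtiyah_comp {n : ℕ} (m : Fin n → ℕ) (l : Fin (∑ i, m i) → ℕ) (p : FM d n)
    (q : ∀ i, FM d (m i)) (i : Fin n) (j : Fin (m i)) :
    weightedAtiyah pt l (FM.comp m p q) (finSigmaFinEquiv ⟨i, j⟩)
      = weightedAtiyah pt (fun i => ∑ j, l (finSigmaFinEquiv ⟨i, j⟩)) p i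
        * weightedAtiyah pt (fun j => l (finSigmaFinEquiv ⟨i, j⟩)) (q i) j := by
  have hdir : ∀ a b, (FM.comp m p q).dir (finSigmaFinEquiv a) (finSigmaFinEquiv b)
      = (compCoord p.1 fun i => (q i).1).1 a b := compFin_dir p.1 fun i => (q i).1
  have hblock : ∀ h, (∏ k, if (⟨h, k⟩ : Σ i, Fin (m i)) = ⟨i, j⟩ then 1
        else pt ((compCoord p.1 fun i => (q i).1).1 ⟨i, j⟩ ⟨h, k⟩)
          ^ l (finSigmaFinEquiv ⟨h, k⟩))
      = (if h = i then 1 else pt (p.dir i h) ^ ∑ k, l (finSigmaFinEquiv ⟨h, k⟩))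
        * if h = i then weightedAtiyah pt (fun j => l (finSigmaFinEquiv ⟨i, j⟩)) (q i) j
          else 1 := by
    intro h
    by_cases hi : h = i
    · subst hi
      simp only [if_true, one_mul, weightedAtiyah_eq_prod_ite, comp_dir_same, FM.dir,
        Sigma.mk.injEq, heq_eq_eq, true_and]
    · have hne : ∀ k, (⟨h, k⟩ : Σ i, Fin (m i)) ≠ ⟨i, j⟩ := fun k e =>
        hi (congrArg Sigma.fst e)
      simp only [if_neg hi, if_neg (hne _), comp_dir_ne _ _ hi, mul_one, FM.dir,
        Finset.prod_pow_eq_pow_sum]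
  rw [weightedAtiyah_eq_prod_ite, weightedAtiyah_eq_prod_ite, ← finSigmaFinEquiv.prod_comp]
  simp only [finSigmaFinEquiv.injective.eq_iff, hdir]
  rw [Fintype.prod_sigma]
  simp only [hblock]
  rw [Finset.prod_mul_distrib, Finset.prod_ite_eq' Finset.univ i, if_pos (Finset.mem_univ i)]

variable {pt} [TopologicalSpace B] [ContinuousMul B]

theorem continuous_weightedAtiyah (hpt : ContinuousOn pt {u | ‖u‖ = 1}) {n : ℕ} (w : Fin n → ℕ)
    (i : Fin n) : Continuous fun p : FM d n => weightedAtiyah pt w p i :=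
  continuous_finsetProd _ fun _ hj =>
    (hpt.comp_continuous (FM.continuous_dir _ _) fun p =>
      p.norm_dir (Finset.ne_of_mem_erase hj)).pow _

theorem continuous_nuPre (hpt : ContinuousOn pt {u | ‖u‖ = 1}) {n : ℕ} (k : Fin n → ℕ) :
    Continuous fun z : FM d n × (∀ i, FMInf (k i) × (Fin (k i) → B)) =>
      nuPre pt k z.1 z.2 := by
  refine Continuous.prodMk ?_ (continuous_pi fun a => ?_)
  · refine (FMInf.continuous_comp k).comp (Continuous.prodMk
      (FM.continuous_toInf.comp continuous_fst) (continuous_pi fun i => ?_))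
    exact continuous_fst.comp ((continuous_apply i).comp continuous_snd)
  · refine ((continuous_weightedAtiyah hpt k _).comp continuous_fst).mul ?_
    exact (continuous_apply _).comp
      (continuous_snd.comp ((continuous_apply _).comp continuous_snd))

end Atiyah

/-! ### The operad action -/

section Action

variable {d : ℕ} {B : Type} [CommMonoid B] {pt : EuclideanSpace ℝ (Fin d) → B}

theorem nuTotal_mk {n : ℕ} (k : Fin n → ℕ) (p : FM d n)
    (x : ∀ i, FMInf (k i) × (Fin (k i) → B)) :
    nuTotal pt n p (fun i => ExtSymTotal.mk (k i) (x i))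
      = ExtSymTotal.mk (∑ i, k i) (nuPre pt k p x) :=
  Sigma.ext rfl (heq_of_eq
    (congrFun (congrFun (Quotient.finLiftOn_mk (S := fun i => extSymSetoid (k i) B) x) _) _))

theorem nuPre_label {n : ℕ} (k : Fin n → ℕ) (p : FM d n)
    (x : ∀ i, FMInf (k i) × (Fin (k i) → B)) (i : Fin n) (j : Fin (k i)) :
    (nuPre pt k p x).2 (finSigmaFinEquiv ⟨i, j⟩) = weightedAtiyah pt k p i * (x i).2 j := by
  simp only [nuPre, Equiv.symm_apply_apply]
  rfl

theorem nuTotal_one (y : Fin 1 → ExtSymTotal B) : nuTotal pt 1 (FM.one d) y = y 0 := by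
  obtain ⟨k, x, hx⟩ : ∃ k x, y = fun _ => ExtSymTotal.mk k x := by
    obtain ⟨k, x, rfl⟩ := ExtSymTotal.exists_rep y
    exact ⟨k 0, x 0, funext fun i => by rw [Subsingleton.elim i 0]⟩
  rw [hx, nuTotal_mk]
  refine ExtSymTotal.mk_eq_mk (blockOne k) (Subtype.ext (one_compFin _ x.1.1).symm) fun j => ?_
  rw [blockOne_symm_apply]
  rw [nuPre_label, weightedAtiyah_fin_one, one_mul]

theorem nuTotal_map {m n : ℕ} (σ : Fin m ≃ Fin n) (p : FM d m) (y : Fin n → ExtSymTotal B) :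
    nuTotal pt n (FM.map σ p) y = nuTotal pt m p fun i => y (σ i) := by
  obtain ⟨k, x, rfl⟩ := ExtSymTotal.exists_rep y
  rw [nuTotal_mk, nuTotal_mk (fun i => k (σ i)) p fun i => x (σ i)]
  refine (ExtSymTotal.mk_eq_mk (blockPerm σ k) (Subtype.ext ?_) fun a => ?_).symm
  · exact compFin_relabel_left σ k (mapDir euclPad p.1) fun i => (x i).1.1
  · obtain ⟨⟨i, j⟩, rfl⟩ := finSigmaFinEquiv.surjective a
    obtain ⟨i, rfl⟩ := σ.surjective i
    rw [blockPerm_symm_apply]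
    rw [nuPre_label, weightedAtiyah_map]
    exact (nuPre_label (fun i => k (σ i)) p (fun i => x (σ i)) i j).symm

theorem nuTotal_comp {n : ℕ} (m : Fin n → ℕ) (p : FM d n) (q : ∀ i, FM d (m i))
    (y : Fin (∑ i, m i) → ExtSymTotal B) :
    nuTotal pt (∑ i, m i) (FM.comp m p q) y
      = nuTotal pt n p fun i => nuTotal pt (m i) (q i) fun j => y (finSigmaFinEquiv ⟨i, j⟩) := by
  obtain ⟨l, x, rfl⟩ := ExtSymTotal.exists_rep y
  have h : ∀ i, (nuTotal pt (m i) (q i) fun j => ExtSymTotal.mk (l (finSigmaFinEquiv ⟨i, j⟩))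
      (x (finSigmaFinEquiv ⟨i, j⟩))) = _ := fun i =>
    nuTotal_mk (fun j => l (finSigmaFinEquiv ⟨i, j⟩)) (q i) fun j => x (finSigmaFinEquiv ⟨i, j⟩)
  simp only [h]
  rw [nuTotal_mk, nuTotal_mk (fun i => ∑ j, l (finSigmaFinEquiv ⟨i, j⟩)) p]
  refine ExtSymTotal.mk_eq_mk (blockAssoc m l) ?_ fun a => ?_
  · simp only [nuPre, FM.toInf_comp]
    exact Subtype.ext (compFin_assoc l _ _ fun c => (x c).1.1).symm
  · obtain ⟨⟨i, b⟩, rfl⟩ := finSigmaFinEquiv.surjective a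
    obtain ⟨⟨j, k⟩, rfl⟩ := finSigmaFinEquiv.surjective b
    rw [blockAssoc_symm_apply]
    rw [nuPre_label, nuPre_label, nuPre_label, weightedAtiyah_comp, mul_assoc]

variable [TopologicalSpace B] [ContinuousMul B]

theorem continuous_nuTotal (hpt : ContinuousOn pt {u | ‖u‖ = 1}) (n : ℕ) :
    Continuous fun z : FM d n × (Fin n → ExtSymTotal B) => nuTotal pt n z.1 z.2 := by
  rw [continuous_iff_continuousAt]
  rintro ⟨p, y⟩
  obtain ⟨k, x, rfl⟩ := ExtSymTotal.exists_rep y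
  -- The map from representatives is open, so continuity at `(p, y)` can be tested on them.
  let π : FM d n × (∀ i, FMInf (k i) × (Fin (k i) → B)) → FM d n × (Fin n → ExtSymTotal B) :=
    Prod.map id (Pi.map fun i => ExtSymTotal.mk (k i))
  have hπ : IsOpenMap π := IsOpenMap.id.prodMap
    (IsOpenMap.piMap (fun i => ExtSymTotal.isOpenMap_mk (k i)) (by simp))
  have hc : Continuous ((fun z : FM d n × (Fin n → ExtSymTotal B) => nuTotal pt n z.1 z.2) ∘ π) :=
    ((ExtSymTotal.continuous_mk _).comp (continuous_nuPre hpt k)).congr fun z =>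
      (nuTotal_mk k z.1 z.2).symm
  exact (tendsto_map'_iff.2 (hc.tendsto (p, x))).mono_left (hπ.nhds_le (p, x))

theorem isOperadAction_nuTotal (hpt : ContinuousOn pt {u | ‖u‖ = 1}) :
    IsOperadAction (fultonMacPherson d) (ExtSymTotal B) (nuTotal pt) where
  continuous_act := continuous_nuTotal hpt
  act_one := nuTotal_one
  act_comp := nuTotal_comp
  act_map := nuTotal_map

end Action

end AtiyahFM

end

theorem mainTheorem1 :
    AtiyahFM.IsOperadAction (AtiyahFM.fultonMacPherson 3)
        (AtiyahFM.ExtSymTotal AtiyahFM.BU1) AtiyahFM.nuComplex ∧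
      AtiyahFM.IsOperadAction (AtiyahFM.fultonMacPherson 2)
        (AtiyahFM.ExtSymTotal AtiyahFM.BO1) AtiyahFM.nuReal :=
  ⟨AtiyahFM.isOperadAction_nuTotal AtiyahFM.continuousOn_ofRoot_stereoComplex,
    AtiyahFM.isOperadAction_nuTotal AtiyahFM.continuousOn_ofRoot_stereoReal⟩
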